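/- Let $\mathcal H=(\mathbb C^2)^{\otimes n}$ and let $R$ be the representation of the symmetric group $S_n$ on $\mathcal H$ that permutes the qubits, $R(\pi)\bigotimes_i|\psi_i\rangle=\bigotimes_i|\psi_{\pi^{-1}(i)}\rangle$. Fix an orthonormal change of basis that brings $R$ to the block form $R(\pi)\cong\bigoplus_\lambda r_\lambda(\pi)\otimes \mathbb 1_{d_\lambda}$, where the $r_\lambda$ are pairwise inequivalent irreducible representations of $S_n$, of dimension $m_\lambda$, and $r_\lambda$ occurs $d_\lambda\ge 1$ times. Correspondingly $\mathcal H=\bigoplus_\lambda\bigoplus_{\nu=1}^{m_\lambda}\mathcal H_\lambda^\nu$ is an orthogonal decomposition with $\dim\mathcal H_\lambda^\nu=d_\lambda$; let $Q_\lambda^\nu$ be the $d_\lambda\times 2^n$ matrix whose adjoint has the chosen orthonormal basis of $\mathcal H_\lambda^\nu$ as its columns, and write $B_\lambda^\nu=Q_\lambda^\nu B(Q_\lambda^\nu)^\dagger$ for an operator $B$ on $\mathcal H$. If $B$ commutes with $R$, then $B_\lambda^\nu$ does not depend on $\nu$ and is denoted $B_\lambda$. Let $U(\vec\theta)=e^{-i\theta_LH_L}\cdots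 e^{-i\theta_1H_1}$ with $\vec\theta\in\mathbb R^L$ and with every $H_l$ in $$\mathcal G=\Big\{\tfrac1n\sum_jX_j,\ \tfrac1n\sum_jY_j,\ \tfrac{2}{n(n-1)}\sum_{k<j}Z_jZ_k\Big\},$$ and let $O$ be in $$\mathcal M=\Big\{\tfrac1n\sum_jX_j,\ \tfrac{2}{n(n-1)}\sum_{k<j}X_jX_k,\ \prod_jX_j\Big\},$$ where $X_j,Y_j,Z_j$ are the Pauli operators on the $j$-th qubit (an empty two-body sum is read as $0$). Let $\rho_1,\dots,\rho_M$ be density matrices on $\mathcal H$, let $c_1,\dots,c_M\in\mathbb R$, $\sigma=\sum_ic_i\rho_i$, and $$\widehat{\mathcal L}(\vec\theta)=\sum_{i=1}^Mc_i\,\mathrm{Tr}\big[U(\vec\theta)\rho_iU(\vec\theta)^\dagger O\big].$$ Let $\vec\theta$ be random with some probability distribution on $\mathbb R^L$, let $1\le\mu\le L$, and write $U(\vec\theta)=U_AU_B$ with $U_B=e^{-i\theta_\mu H_\mu}\cdots e^{-i\theta_1H_1}$ and $U_A=e^{-i\theta_LH_L}\cdots e^{-i\theta_{\mu+1}H_{\mu+1}}$.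 Assume that the blocks $U_{A,\lambda}$ and $U_{B,\lambda}$, for all $\lambda$, form independent unitary 2-designs, in the following sense. Call a linear combination of products of $s\le2$ matrix entries of $V$ and $s$ complex conjugates of matrix entries of $V$ a balanced polynomial of degree at most $2$ in $V$. Then for all balanced polynomials $f_\lambda,g_\lambda$ of degree at most $2$, $$\Big\langle\prod_\lambda f_\lambda(U_{A,\lambda})\,g_\lambda(U_{B,\lambda})\Big\rangle_{\vec\theta}=\prod_\lambda\int_{\mathbb U(d_\lambda)}f_\lambda(V)\,dV\int_{\mathbb U(d_\lambda)}g_\lambda(V)\,dV,$$ where $dV$ is the Haar probability measure. Then $\partial_\mu\widehat{\mathcal L}=\partial\widehat{\mathcal L}/\partial\theta_\mu$ exists everywhere and is square-integrable, $$\langle\partial_\mu\widehat{\mathcal L}(\vec\theta)\rangle_{\vec\theta}=0,\qquad \mathrm{Var}_{\vec\theta}\big[\partial_\mu\widehat{\mathcal L}(\vec\theta)\big]=\sum_\lambda\frac{2d_\lambda}{(d_\lambda^2-1)^2}\,\Delta(H_{\mu,\lambda})\,\Delta(O_\lambda)\,\Delta\Big(\sum_{\nu=1}^{m_\lambda}\sigma_\lambda^\nu\Big),$$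 where $\Delta(B)=\mathrm{Tr}[B^2]-\mathrm{Tr}[B]^2/\dim(B)$ and the terms with $d_\lambda=1$ (for which every $\Delta$ vanishes) are read as $0$. -/

import Mathlib

open MeasureTheory
open scoped Matrix ComplexOrder

noncomputable section

namespace EquivariantQNN

/-! ### Operators on `n` qubits -/

/-- Operators on `(ℂ²)^{⊗n}`, as matrices in the computational basis, whose elements are labelled by
the bit strings `Fin n → Fin 2`. -/
abbrev Op (n : ℕ) : Type := Matrix (Fin n → Fin 2) (Fin n → Fin 2) ℂ

def pauliX : Matrix (Fin 2) (Fin 2) ℂ := !![0, 1; 1, 0]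

def pauliY : Matrix (Fin 2) (Fin 2) ℂ := !![0, -Complex.I; Complex.I, 0]

def pauliZ : Matrix (Fin 2) (Fin 2) ℂ := !![1, 0; 0, -1]

/-- The tensor product `A 0 ⊗ ⋯ ⊗ A (n-1)` of single-qubit operators. -/
def tensorOp {n : ℕ} (A : Fin n → Matrix (Fin 2) (Fin 2) ℂ) : Op n :=
  Matrix.of fun x y => ∏ j, A j (x j) (y j)

/-- The single-qubit operator `A` acting on the `j`-th qubit, tensored with the identity on all the
other qubits. -/
def onQubit {n : ℕ} (j : Fin n) (A : Matrix (Fin 2) (Fin 2) ℂ) : Op n :=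
  tensorOp (Function.update (fun _ => 1) j A)

/-- `(1/n) ∑_j χ_j`. -/
def oneBody (n : ℕ) (χ : Matrix (Fin 2) (Fin 2) ℂ) : Op n :=
  (1 / (n : ℂ)) • ∑ j : Fin n, onQubit j χ

/-- `(2/(n(n-1))) ∑_{k<j} χ_j χ_k`. -/
def twoBody (n : ℕ) (χ : Matrix (Fin 2) (Fin 2) ℂ) : Op n :=
  (2 / ((n : ℂ) * ((n : ℂ) - 1))) •
    ∑ j : Fin n, ∑ k ∈ Finset.univ.filter (· < j), onQubit j χ * onQubit k χ

/-- The set of generators `𝒢`. -/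
def generators (n : ℕ) : Set (Op n) :=
  {oneBody n pauliX, oneBody n pauliY, twoBody n pauliZ}

/-- The set of measurement operators `ℳ`; the last one is `∏_j X_j = X ⊗ ⋯ ⊗ X`. -/
def measurements (n : ℕ) : Set (Op n) :=
  {oneBody n pauliX, twoBody n pauliX, tensorOp fun _ => pauliX}

/-- Density matrices. -/
def IsDensityMatrix {n : ℕ} (ρ : Op n) : Prop := ρ.PosSemidef ∧ ρ.trace = 1

/-! ### The layered circuit and the empirical loss -/

/-- The unitary `∏ e^{-i θ_l H_l}` of the layers `l` with `p l`; the layer with the smallest index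
acts first, so it is the rightmost factor. -/
def layers {n L : ℕ} (H : Fin L → Op n) (p : Fin L → Prop) [DecidablePred p]
    (θ : Fin L → ℝ) : Op n :=
  (((List.finRange L).filter fun l => decide (p l)).reverse.map fun l =>
    NormedSpace.exp ((-(Complex.I * (θ l : ℂ))) • H l)).prod

/-- The QNN unitary `U(θ) = e^{-i θ_L H_L} ⋯ e^{-i θ_1 H_1}`. -/
def circuit {n L : ℕ} (H : Fin L → Op n) (θ : Fin L → ℝ) : Op n :=
  layers H (fun _ => True) θ

/-- The two parts `U(θ) = U_A U_B` into which the layer `μ` divides the QNN: `U_A` (for `true`)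
consists of the layers `l > μ`, and `U_B` (for `false`) of the layers `l ≤ μ`. -/
def circuitPart {n L : ℕ} (H : Fin L → Op n) (μ : Fin L) : Bool → (Fin L → ℝ) → Op n
  | true => layers H (fun l => μ < l)
  | false => layers H (fun l => l ≤ μ)

/-- The loss `ℓ_θ(ρ) = Tr[U(θ) ρ U(θ)† O]` (a real number for Hermitian `ρ` and `O`). -/
def loss {n L : ℕ} (H : Fin L → Op n) (O ρ : Op n) (θ : Fin L → ℝ) : ℝ :=
  (Matrix.trace (circuit H θ * ρ * (circuit H θ)ᴴ * O)).re

/-- The empirical loss `∑_i c_i ℓ_θ(ρ_i)`. -/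
def empiricalLoss {n L M : ℕ} (H : Fin L → Op n) (O : Op n) (c : Fin M → ℝ)
    (ρ : Fin M → Op n) (θ : Fin L → ℝ) : ℝ :=
  ∑ i, c i * loss H O (ρ i) θ

/-- The partial derivative of `F` in the coordinate `μ`. -/
def partialDeriv {L : ℕ} (F : (Fin L → ℝ) → ℝ) (μ : Fin L) (θ : Fin L → ℝ) : ℝ :=
  deriv (fun t : ℝ => F (Function.update θ μ t)) (θ μ)

/-! ### The qubit-defining representation and its isotypic decomposition -/

/-- The qubit-defining representation
`R(π) (ψ_1 ⊗ ⋯ ⊗ ψ_n) = ψ_{π⁻¹(1)} ⊗ ⋯ ⊗ ψ_{π⁻¹(n)}` of the symmetric group. -/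
def qubitRep {n : ℕ} (π : Equiv.Perm (Fin n)) : Op n :=
  Matrix.of fun y x => if y = x ∘ ⇑π⁻¹ then 1 else 0

/-- An orthonormal change of basis that brings the qubit-defining representation to the block form
`R(π) ≅ ⨁_λ r_λ(π) ⊗ 1_{d_λ}`, where the `r_λ` are pairwise inequivalent irreducible
representations of `S_n`, of dimension `m_λ`, and `r_λ` appears `d_λ ≥ 1` times.
The rows of `Q λ ν` are (the adjoints of) the vectors `|v_1⟩, …, |v_{d_λ}⟩` of the chosen
orthonormal basis that span the subspace `ℋ_λ^ν`, for `ν = 1, …, m_λ`. -/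
structure IsotypicDecomposition (n : ℕ) (Λ : Type) [Fintype Λ] where
  d : Λ → ℕ
  m : Λ → ℕ
  Q : (lam : Λ) → Fin (m lam) → Matrix (Fin (d lam)) (Fin n → Fin 2) ℂ
  r : (lam : Λ) → Representation ℂ (Equiv.Perm (Fin n)) (Fin (m lam) → ℂ)
  d_pos : ∀ lam, 0 < d lam
  orthonormal_same : ∀ lam ν, Q lam ν * (Q lam ν)ᴴ = 1
  orthogonal_copies : ∀ lam ν ν', ν ≠ ν' → Q lam ν * (Q lam ν')ᴴ = 0
  orthogonal_irreps : ∀ lam lam' ν ν', lam ≠ lam' → Q lam ν * (Q lam' ν')ᴴ = 0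
  complete : ∑ lam, ∑ ν, (Q lam ν)ᴴ * Q lam ν = 1
  irreducible : ∀ lam, (r lam).IsIrreducible
  inequivalent : ∀ lam lam', lam ≠ lam' → IsEmpty ((r lam).Equiv (r lam'))
  decomposition : ∀ π : Equiv.Perm (Fin n), qubitRep π =
    ∑ lam, ∑ ν, ∑ ν', LinearMap.toMatrix' (r lam π) ν ν' • ((Q lam ν)ᴴ * Q lam ν')

/-- The restriction `B_λ^ν = Q_λ^ν B (Q_λ^ν)†` of an operator to `ℋ_λ^ν`. -/
def IsotypicDecomposition.restrict {n : ℕ} {Λ : Type} [Fintype Λ]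
    (D : IsotypicDecomposition n Λ) (lam : Λ) (ν : Fin (D.m lam)) (B : Op n) :
    Matrix (Fin (D.d lam)) (Fin (D.d lam)) ℂ :=
  D.Q lam ν * B * (D.Q lam ν)ᴴ

/-- `Δ(B) = Tr[B²] - Tr[B]²/dim B`. -/
def Delta {d : ℕ} (B : Matrix (Fin d) (Fin d) ℂ) : ℂ :=
  (B * B).trace - B.trace ^ 2 / (d : ℂ)

/-! ### Haar measure on `U(d)` and unitary 2-designs -/

instance compactSpace_unitaryGroup (d : ℕ) : CompactSpace (Matrix.unitaryGroup (Fin d) ℂ) := by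
  refine (isCompact_iff_compactSpace
    (s := (Matrix.unitaryGroup (Fin d) ℂ : Set (Matrix (Fin d) (Fin d) ℂ)))).mp ?_
  have hsub : (Matrix.unitaryGroup (Fin d) ℂ : Set (Matrix (Fin d) (Fin d) ℂ)) ⊆
      Set.univ.pi fun _ => Set.univ.pi fun _ => Metric.closedBall (0 : ℂ) 1 := by
    intro U hU i _ j _
    simpa using entry_norm_bound_of_unitary hU i j
  have hcompact : IsCompact (Set.univ.pi fun _ : Fin d => Set.univ.pi fun _ : Fin d =>
      Metric.closedBall (0 : ℂ) 1) :=
    isCompact_univ_pi fun _ => isCompact_univ_pi fun _ => isCompact_closedBall _ _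
  exact hcompact.of_isClosed_subset (isClosed_unitary (R := Matrix (Fin d) (Fin d) ℂ)) hsub

instance measurableSpace_unitaryGroup (d : ℕ) :
    MeasurableSpace (Matrix.unitaryGroup (Fin d) ℂ) := borel _

instance borelSpace_unitaryGroup (d : ℕ) : BorelSpace (Matrix.unitaryGroup (Fin d) ℂ) := ⟨rfl⟩

/-- The Haar probability measure on `U(d)`. -/
def haarUnitary (d : ℕ) : Measure (Matrix.unitaryGroup (Fin d) ℂ) :=
  Measure.haarMeasure ⊤

/-- The monomials `∏_{a<s} V_{i_a j_a} · conj V_{k_a l_a}`, of the same degree `s ≤ t` in the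
entries of `V` and in their complex conjugates. -/
def balancedMonomials (t d : ℕ) : Set (Matrix (Fin d) (Fin d) ℂ → ℂ) :=
  {f | ∃ s ≤ t, ∃ i j k l : Fin s → Fin d,
    f = fun V => ∏ a, (V (i a) (j a) * star (V (k a) (l a)))}

/-- Balanced polynomials of degree at most `t`. On unitaries these are exactly the linear
combinations of the matrix entries of `V^{⊗t} B (V†)^{⊗t}` (together with the constants), so
the functions whose averages a unitary `t`-design reproduces. -/
def balancedPolynomials (t d : ℕ) : Submodule ℂ (Matrix (Fin d) (Fin d) ℂ → ℂ) :=
  Submodule.span ℂ (balancedMonomials t d)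

/-- The finite family `V_k` of random matrices on the probability space `(Ω, P)` forms independent
unitary `t`-designs in `U(d_k)`: products of balanced polynomials of degree at most `t`, one in
each `V_k`, have the same mean as for independent Haar-distributed unitaries,
`𝔼[∏_k f_k(V_k)] = ∏_k ∫_{U(d_k)} f_k(V) dV`. -/
def FormsIndependentDesigns (t : ℕ) {Ω : Type} [MeasurableSpace Ω] (P : Measure Ω)
    {K : Type} [Fintype K] (d : K → ℕ)
    (V : (k : K) → Ω → Matrix (Fin (d k)) (Fin (d k)) ℂ) : Prop :=
  ∀ f : (k : K) → Matrix (Fin (d k)) (Fin (d k)) ℂ → ℂ,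
    (∀ k, f k ∈ balancedPolynomials t (d k)) →
      ∫ ω, ∏ k, f k (V k ω) ∂P = ∏ k, ∫ W, f k (W : Matrix _ _ ℂ) ∂(haarUnitary (d k))

end EquivariantQNN

end

/-!
The derivative of the loss in `θ_μ` is the expectation value
`∂_μ ℒ = Tr[i [H_μ, U_A† O U_A] · U_B σ U_B†]`. The generators and the measurements are invariant
under permutations of the qubits, so `H_μ`, `O`, `U_A` and `U_B` commute with the
qubit-defining representation. By Schur's lemma they are block diagonal, with the same block
`B_λ` on every copy of `r_λ`, and the restriction to a block is multiplicative
(`IsotypicDecomposition.restrict_mul`). Hence (`lossGradient_eq_sum`)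
`∂_μ ℒ = ∑_λ Tr[C_λ · V_λ S_λ V_λ†]` with `C_λ = i [H_{μ,λ}, W_λ† O_λ W_λ]`,
`S_λ = ∑_ν σ_λ^ν`, and with `W_λ`, `V_λ` the blocks of `U_A`, `U_B`.

The entries of `C_λ` and of `V_λ S_λ V_λ†` are balanced polynomials of degree one in `W_λ` and in
`V_λ`, so in the mean and in the second moment of `∂_μ ℒ` the blocks may be replaced by independent
Haar unitaries. The Haar mean of `W† O W` is scalar, hence `C_λ` has mean zero: the mean of `∂_μ ℒ`
and all the cross terms between different blocks vanish.

For the remaining terms one needs the second moments of a random matrix `Y` whose law is invariant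
under unitary conjugation and for which `Tr Y = Tr X` and `Tr Y² = Tr X²` are constant. They have
the form `𝔼[Y_ij Y_kl] = a δ_ij δ_kl + b δ_il δ_jk` with `b = Δ(X) / (d² - 1)`
(`IsConjInvariant.exists_integral_mul_entry_of_trace`); three kinds of unitaries, namely diagonal
phases, permutations of the basis and one mixing two basis vectors, suffice for this. Since
`Tr C_λ = 0`, the average over `V_λ` gives `Δ(S_λ) / (d_λ² - 1) · Tr C_λ²`, and the average of
`Tr C_λ² = 2 Tr[H² Y²] - 2 Tr[H Y H Y]`, with `Y = W† O W`, is
`2 d_λ Δ(H_λ) Δ(O_λ) / (d_λ² - 1)`.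

Square-integrability holds because the derivative is a continuous function of `U_A` and `U_B`, which
range over a compact group.
-/

noncomputable section

namespace EquivariantQNN

/-! ### Conjugation-invariant random matrices -/

/-- The random matrix `Y` has the same law as `G Y G†` for every unitary `G`. The law is tested
against continuous functions, all of which are required to be integrable. -/
structure IsConjInvariant {Ω : Type*} [MeasurableSpace Ω] {d : ℕ} (ν : Measure Ω)
    (Y : Ω → Matrix (Fin d) (Fin d) ℂ) : Prop where
  integrable : ∀ φ : Matrix (Fin d) (Fin d) ℂ → ℂ, Continuous φ →
    Integrable (fun ω => φ (Y ω)) ν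
  integral_conj : ∀ G ∈ Matrix.unitaryGroup (Fin d) ℂ, ∀ φ : Matrix (Fin d) (Fin d) ℂ → ℂ,
    Continuous φ → ∫ ω, φ (G * Y ω * Gᴴ) ∂ν = ∫ ω, φ (Y ω) ∂ν

/-- The diagonal unitary with entry `i` at position `p` and `1` elsewhere. -/
def phaseVec {d : ℕ} (p : Fin d) : Fin d → ℂ := fun a => if a = p then Complex.I else 1

lemma diagonal_phaseVec_mem {d : ℕ} (p : Fin d) :
    Matrix.diagonal (phaseVec p) ∈ Matrix.unitaryGroup (Fin d) ℂ := by
  rw [Matrix.mem_unitaryGroup_iff, Matrix.star_eq_conjTranspose, Matrix.diagonal_conjTranspose,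
    Matrix.diagonal_mul_diagonal, ← Matrix.diagonal_one]
  congr 1
  funext a
  by_cases h : a = p <;> simp [phaseVec, h]

lemma diagonal_conj_apply {d : ℕ} (z : Fin d → ℂ) (Y : Matrix (Fin d) (Fin d) ℂ) (i j : Fin d) :
    (Matrix.diagonal z * Y * (Matrix.diagonal z)ᴴ) i j = z i * star (z j) * Y i j := by
  rw [Matrix.diagonal_conjTranspose, Matrix.mul_diagonal, Matrix.diagonal_mul, Pi.star_apply]
  ring

/-- The matrix of a permutation of the basis vectors. -/
def basisPerm {d : ℕ} (σ : Equiv.Perm (Fin d)) : Matrix (Fin d) (Fin d) ℂ :=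
  (1 : Matrix (Fin d) (Fin d) ℂ).submatrix σ id

lemma basisPerm_conj {d : ℕ} (σ : Equiv.Perm (Fin d)) (Y : Matrix (Fin d) (Fin d) ℂ) :
    basisPerm σ * Y * (basisPerm σ)ᴴ = Y.submatrix σ σ := by
  ext i j
  simp [basisPerm, Matrix.mul_apply, Matrix.one_apply]

lemma basisPerm_mem {d : ℕ} (σ : Equiv.Perm (Fin d)) :
    basisPerm σ ∈ Matrix.unitaryGroup (Fin d) ℂ := by
  rw [Matrix.mem_unitaryGroup_iff, Matrix.star_eq_conjTranspose]
  have h := basisPerm_conj σ 1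
  rw [Matrix.mul_one] at h
  rw [h, Matrix.submatrix_one_equiv]

/-- The unitary `1 - (1 - i) P`, where `P` projects onto the span of `e_i + e_k`; it maps `e_i` to
an equal-weight superposition of `e_i` and `e_k`. -/
def mixer {d : ℕ} (i k : Fin d) : Matrix (Fin d) (Fin d) ℂ :=
  1 - ((1 - Complex.I) / 2) •
    Matrix.vecMulVec (Pi.single i 1 + Pi.single k 1) (Pi.single i 1 + Pi.single k 1)

lemma mixer_mem {d : ℕ} {i k : Fin d} (h : i ≠ k) :
    mixer i k ∈ Matrix.unitaryGroup (Fin d) ℂ := by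
  rw [Matrix.mem_unitaryGroup_iff, Matrix.star_eq_conjTranspose]
  set v : Fin d → ℂ := Pi.single i 1 + Pi.single k 1 with hv
  have hsq : Matrix.vecMulVec v v * Matrix.vecMulVec v v = (2 : ℂ) • Matrix.vecMulVec v v := by
    rw [Matrix.vecMulVec_mul_vecMulVec]
    have : v ⬝ᵥ v = 2 := by
      simp [hv, dotProduct_add, h, h.symm]
      norm_num
    rw [this]
    ext
    simp [Matrix.vecMulVec_apply]
    ring
  have hstar : star v = v := by
    funext a
    simp [hv, Pi.single_apply]
  have hH : (Matrix.vecMulVec v v)ᴴ = Matrix.vecMulVec v v := by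
    rw [Matrix.conjTranspose_vecMulVec, hstar]
  rw [mixer, ← hv, Matrix.conjTranspose_sub, Matrix.conjTranspose_smul, hH,
    Matrix.conjTranspose_one]
  simp only [sub_mul, mul_sub, Matrix.smul_mul, Matrix.mul_smul, hsq, smul_smul, Matrix.mul_one,
    Matrix.one_mul]
  have hs : star ((1 - Complex.I) / 2) = (1 + Complex.I) / 2 := by simp
  rw [hs]
  have h0 : (1 - Complex.I) / 2 + (1 + Complex.I) / 2 -
      (1 + Complex.I) / 2 * ((1 - Complex.I) / 2 * 2) = 0 := by
    linear_combination (1 / 2 : ℂ) * Complex.I_sq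
  have h1 := congrArg (fun c : ℂ => c • Matrix.vecMulVec v v) h0
  simp only [zero_smul] at h1
  rw [sub_smul, add_smul] at h1
  rw [sub_eq_zero] at h1
  rw [sub_sub_eq_add_sub, ← sub_add_eq_add_sub, ← h1]
  abel

lemma mixer_conj_apply {d : ℕ} {i k : Fin d} (h : i ≠ k) (Y : Matrix (Fin d) (Fin d) ℂ) :
    (mixer i k * Y * (mixer i k)ᴴ) i i =
      (Y i i + Y k k - Complex.I * Y i k + Complex.I * Y k i) / 2 := by
  have hrow : ∀ a, mixer i k i a = (if a = i then (1 + Complex.I) / 2 else 0) +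
      (if a = k then -((1 - Complex.I) / 2) else 0) := by
    intro a
    by_cases h1 : a = i
    · subst h1
      simp [mixer, Matrix.vecMulVec_apply, h]
      ring
    · by_cases h2 : a = k
      · subst h2
        simp [mixer, Matrix.vecMulVec_apply, h, h.symm]
      · simp [mixer, Matrix.vecMulVec_apply, h1, h2, h, Ne.symm h1]
  simp only [Matrix.mul_apply, Matrix.conjTranspose_apply, hrow, star_add, add_mul, mul_add,
    Finset.sum_add_distrib, ite_mul, zero_mul, apply_ite star, star_zero, mul_ite, mul_zero,
    Finset.sum_ite_eq', Finset.mem_univ, if_true]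
  simp
  ring_nf
  simp only [Complex.I_sq]
  ring

namespace IsConjInvariant

variable {Ω : Type*} [MeasurableSpace Ω] {d : ℕ} {ν : Measure Ω}
  {Y : Ω → Matrix (Fin d) (Fin d) ℂ}

/-- The mean of a conjugation-invariant random matrix is a scalar matrix. -/
lemma exists_integral_entry (hY : IsConjInvariant ν Y) :
    ∃ a : ℂ, ∀ i j, ∫ ω, Y ω i j ∂ν = if i = j then a else 0 := by
  have hoff : ∀ i j, i ≠ j → ∫ ω, Y ω i j ∂ν = 0 := by
    intro i j hij
    have h := hY.integral_conj _ (diagonal_phaseVec_mem i) (fun A => A i j) (by fun_prop)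
    simp only [diagonal_conj_apply, integral_const_mul] at h
    simp only [phaseVec, hij.symm, if_true, if_false, star_one, mul_one] at h
    have h2 : (Complex.I - 1) * ∫ ω, Y ω i j ∂ν = 0 := by linear_combination h
    refine (mul_eq_zero.mp h2).resolve_left fun h3 => ?_
    have := congrArg Complex.re h3
    norm_num at this
  rcases isEmpty_or_nonempty (Fin d) with hd | ⟨⟨o⟩⟩
  · exact ⟨0, fun i => hd.elim i⟩
  · refine ⟨∫ ω, Y ω o o ∂ν, fun i j => ?_⟩
    split_ifs with hij
    · subst hij
      have h := hY.integral_conj _ (basisPerm_mem (Equiv.swap o i)) (fun A => A o o) (by fun_prop)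
      simpa [basisPerm_conj] using h
    · exact hoff i j hij

/-- Invariance under diagonal phases: the moment `𝔼[Y_ij Y_kl]` vanishes unless
`{i, k} = {j, l}`. -/
lemma integral_mul_entry_of_ne (hY : IsConjInvariant ν Y) {i j k l : Fin d}
    (h1 : ¬(i = j ∧ k = l)) (h2 : ¬(i = l ∧ j = k)) : ∫ ω, Y ω i j * Y ω k l ∂ν = 0 := by
  have key : ∀ p, (phaseVec p i * star (phaseVec p j) * (phaseVec p k * star (phaseVec p l)) - 1) *
      ∫ ω, Y ω i j * Y ω k l ∂ν = 0 := by
    intro p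
    have h := hY.integral_conj _ (diagonal_phaseVec_mem p) (fun A => A i j * A k l) (by fun_prop)
    simp only [diagonal_conj_apply, mul_mul_mul_comm _ (Y _ i j), integral_const_mul] at h
    linear_combination h
  have hI : Complex.I - 1 ≠ 0 := fun h3 => by
    have := congrArg Complex.re h3
    norm_num at this
  -- Put the phase at an index that occurs more often in `{i, k}` than in `{j, l}`: the moment is
  -- then multiplied by `i` or by `-1`.
  by_cases hij : i = j
  · subst hij
    have hkl : k ≠ l := fun h => h1 ⟨rfl, h⟩
    refine (mul_eq_zero.mp (key k)).resolve_left ?_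
    by_cases hik : i = k
    · simpa [phaseVec, hik, hkl.symm] using hI
    · simpa [phaseVec, hik, hkl.symm] using hI
  · by_cases hil : i = l
    · subst hil
      have hjk : j ≠ k := fun h => h2 ⟨rfl, h⟩
      refine (mul_eq_zero.mp (key k)).resolve_left ?_
      by_cases hik : i = k
      · simpa [phaseVec, hik, hjk] using hI
      · simpa [phaseVec, hik, hjk] using hI
    · refine (mul_eq_zero.mp (key i)).resolve_left ?_
      by_cases hik : i = k
      · subst hik
        simp [phaseVec, Ne.symm hij, Ne.symm hil]
        norm_num
      · simpa [phaseVec, Ne.symm hij, Ne.symm hil, Ne.symm hik] using hI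

lemma integral_mul_entry_perm (hY : IsConjInvariant ν Y) (σ : Equiv.Perm (Fin d))
    (i j k l : Fin d) :
    ∫ ω, Y ω (σ i) (σ j) * Y ω (σ k) (σ l) ∂ν = ∫ ω, Y ω i j * Y ω k l ∂ν := by
  have h := hY.integral_conj _ (basisPerm_mem σ) (fun A => A i j * A k l) (by fun_prop)
  simpa [basisPerm_conj] using h

/-- The second-moment tensor of a conjugation-invariant random matrix is a combination of the
identity and the swap. Diagonal phases kill all other entries, basis permutations leave three
parameters, and the unitary `mixer` gives the remaining linear relation. -/
lemma exists_integral_mul_entry (hY : IsConjInvariant ν Y) (hd : 2 ≤ d) :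
    ∃ a b : ℂ, ∀ i j k l, ∫ ω, Y ω i j * Y ω k l ∂ν =
      (if i = j ∧ k = l then a else 0) + (if i = l ∧ j = k then b else 0) := by
  obtain ⟨o, q, hoq⟩ : ∃ o q : Fin d, o ≠ q :=
    ⟨⟨0, by omega⟩, ⟨1, by omega⟩, by simp [Fin.ext_iff]⟩
  set a := ∫ ω, Y ω o o * Y ω q q ∂ν with ha
  set b := ∫ ω, Y ω o q * Y ω q o ∂ν with hb
  have hperm : ∀ i k, i ≠ k → ∃ σ : Equiv.Perm (Fin d), σ o = i ∧ σ q = k := by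
    intro i k hik
    refine ⟨Equiv.swap (Equiv.swap o i q) k * Equiv.swap o i, ?_, ?_⟩
    · rw [Equiv.Perm.mul_apply, Equiv.swap_apply_left, Equiv.swap_apply_of_ne_of_ne _ hik]
      intro h
      have := congrArg (Equiv.swap o i) h
      simp at this
      exact hoq this
    · simp
  have h1 : ∀ i k, i ≠ k → ∫ ω, Y ω i i * Y ω k k ∂ν = a := by
    intro i k hik
    obtain ⟨σ, rfl, rfl⟩ := hperm i k hik
    exact hY.integral_mul_entry_perm σ o o q q
  have h2 : ∀ i k, i ≠ k → ∫ ω, Y ω i k * Y ω k i ∂ν = b := by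
    intro i k hik
    obtain ⟨σ, rfl, rfl⟩ := hperm i k hik
    exact hY.integral_mul_entry_perm σ o q q o
  have h3 : ∀ i, ∫ ω, Y ω i i * Y ω i i ∂ν = ∫ ω, Y ω o o * Y ω o o ∂ν := by
    intro i
    have := hY.integral_mul_entry_perm (Equiv.swap o i) o o o o
    simpa using this
  have hint : ∀ i j k l, Integrable (fun ω => Y ω i j * Y ω k l) ν := fun i j k l =>
    hY.integrable (fun A => A i j * A k l) (by fun_prop)
  have h4 : ∫ ω, Y ω o o * Y ω o o ∂ν = a + b := by
    set g := ∫ ω, Y ω o o * Y ω o o ∂ν with hg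
    have h := hY.integral_conj _ (mixer_mem hoq) (fun A => A o o * A o o) (by fun_prop)
    simp only [mixer_conj_apply hoq, ← hg] at h
    -- The square of the transformed diagonal entry, as a double sum over the four
    -- entries of `Y` in it.
    have hexp : ∀ ω, (Y ω o o + Y ω q q - Complex.I * Y ω o q + Complex.I * Y ω q o) / 2 *
        ((Y ω o o + Y ω q q - Complex.I * Y ω o q + Complex.I * Y ω q o) / 2) =
        ∑ s : Fin 4, ∑ t : Fin 4, (![1, 1, -Complex.I, Complex.I] s / 2 *
          (![1, 1, -Complex.I, Complex.I] t / 2)) *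
          (Y ω (![o, q, o, q] s) (![o, q, q, o] s) *
          Y ω (![o, q, o, q] t) (![o, q, q, o] t)) := by
      intro ω
      simp [Fin.sum_univ_succ]
      ring
    simp only [hexp] at h
    rw [integral_finsetSum _ fun s _ => integrable_finsetSum _ fun t _ => (hint _ _ _ _).const_mul _]
      at h
    simp only [integral_finsetSum _ fun t _ => (hint _ _ _ _).const_mul _, integral_const_mul] at h
    have e0 := h1 o q hoq
    have e1 := h1 q o hoq.symm
    have e2 := h2 o q hoq
    have e3 := h2 q o hoq.symm
    have e4 := h3 q
    have z : ∀ {i j k l : Fin d}, ¬(i = j ∧ k = l) → ¬(i = l ∧ j = k) →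
      ∫ ω, Y ω i j * Y ω k l ∂ν = 0 := fun x y => hY.integral_mul_entry_of_ne x y
    have z1 := @z o o o q (by simp [hoq]) (by simp [hoq])
    have z2 := @z o o q o (by simp [hoq.symm]) (by simp [hoq])
    have z3 := @z q q o q (by simp [hoq]) (by simp [hoq.symm])
    have z4 := @z q q q o (by simp [hoq.symm]) (by simp [hoq.symm])
    have z5 := @z o q o o (by simp [hoq]) (by simp [hoq.symm])
    have z6 := @z o q q q (by simp [hoq]) (by simp [hoq])
    have z7 := @z o q o q (by simp [hoq]) (by simp [hoq])
    have z8 := @z q o o o (by simp [hoq.symm]) (by simp [hoq.symm])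
    have z9 := @z q o q q (by simp [hoq.symm]) (by simp [hoq])
    have z10 := @z q o q o (by simp [hoq.symm]) (by simp [hoq.symm])
    simp [Fin.sum_univ_succ, e0, e1, e2, e3, e4, ← hg, z1, z2, z3, z4, z5, z6, z7, z8, z9, z10] at h
    ring_nf at h
    simp only [Complex.I_sq] at h
    linear_combination -2 * h
  refine ⟨a, b, fun i j k l => ?_⟩
  by_cases hA : i = j ∧ k = l
  · obtain ⟨rfl, rfl⟩ := hA
    by_cases hik : i = k
    · subst hik
      simp [h3, h4]
    · simp [hik, h1 i k hik]
  · by_cases hB : i = l ∧ j = k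
    · obtain ⟨rfl, rfl⟩ := hB
      have : i ≠ j := fun h => hA ⟨h, h.symm⟩
      simp [this, h2 i j this]
    · simp [hA, hB, hY.integral_mul_entry_of_ne hA hB]

/-- The second moments of a conjugation-invariant random matrix with the spectral data of a fixed
matrix `X`: the coefficient of the swap is `Δ(X) / (d² - 1)`. -/
lemma exists_integral_mul_entry_of_trace [IsProbabilityMeasure ν] (hY : IsConjInvariant ν Y)
    (hd : 2 ≤ d) (X : Matrix (Fin d) (Fin d) ℂ) (htr : ∀ ω, (Y ω).trace = X.trace)
    (hsq : ∀ ω, (Y ω * Y ω).trace = (X * X).trace) :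
    ∃ a : ℂ, ∀ i j k l, ∫ ω, Y ω i j * Y ω k l ∂ν =
      (if i = j ∧ k = l then a else 0) +
        (if i = l ∧ j = k then Delta X / ((d : ℂ) ^ 2 - 1) else 0) := by
  obtain ⟨a, b, hab⟩ := hY.exists_integral_mul_entry hd
  have hint : ∀ i j k l, Integrable (fun ω => Y ω i j * Y ω k l) ν := fun i j k l =>
    hY.integrable (fun A => A i j * A k l) (by fun_prop)
  -- The two contractions `𝔼[(Tr Y)²]` and `𝔼[Tr Y²]` determine the two coefficients.
  have e1 : X.trace * X.trace = (d : ℂ) ^ 2 * a + d * b := by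
    have h : ∫ ω, (Y ω).trace * (Y ω).trace ∂ν = X.trace * X.trace := by simp [htr]
    simp only [Matrix.trace, Matrix.diag_apply, Finset.sum_mul_sum] at h
    rw [integral_finsetSum _ fun s _ => integrable_finsetSum _ fun t _ => hint _ _ _ _] at h
    simp only [integral_finsetSum _ fun t _ => hint _ _ _ _, hab] at h
    rw [Matrix.trace]
    simp only [Matrix.diag_apply, Finset.sum_mul_sum]
    rw [← h]
    simp [Finset.sum_add_distrib, sq]
    ring
  have e2 : (X * X).trace = d * a + (d : ℂ) ^ 2 * b := by
    have h : ∫ ω, (Y ω * Y ω).trace ∂ν = (X * X).trace := by simp [hsq]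
    rw [← h]
    simp only [Matrix.trace, Matrix.diag_apply, Matrix.mul_apply]
    rw [integral_finsetSum _ fun s _ => integrable_finsetSum _ fun t _ => hint _ _ _ _]
    simp only [integral_finsetSum _ fun t _ => hint _ _ _ _, hab]
    simp [Finset.sum_add_distrib, sq, ite_and]
    ring
  have hd0 : (d : ℂ) ≠ 0 := by
    have : d ≠ 0 := by omega
    exact_mod_cast this
  have hd1 : (d : ℂ) ^ 2 - 1 ≠ 0 := by
    intro h
    have h' : (d : ℂ) ^ 2 = 1 := by linear_combination h
    have h'' : d ^ 2 = 1 := by exact_mod_cast h'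
    nlinarith
  have hb : Delta X / ((d : ℂ) ^ 2 - 1) = b := by
    rw [Delta, sq X.trace, e1, e2]
    field_simp
    ring
  exact ⟨a, by rw [hb]; exact hab⟩

end IsConjInvariant

/-! ### Haar measure on the unitary group -/

instance isHaarMeasure_haarUnitary (d : ℕ) : (haarUnitary d).IsHaarMeasure := by
  unfold haarUnitary; infer_instance

instance isProbabilityMeasure_haarUnitary (d : ℕ) : IsProbabilityMeasure (haarUnitary d) :=
  ⟨Measure.haarMeasure_self⟩

/-- The unitary group is compact, hence unimodular. -/
instance isMulRightInvariant_haarUnitary (d : ℕ) : (haarUnitary d).IsMulRightInvariant := by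
  refine ⟨fun g => ?_⟩
  have : IsProbabilityMeasure (Measure.map (fun x => x * g) (haarUnitary d)) :=
    Measure.isProbabilityMeasure_map (measurable_mul_const g).aemeasurable
  exact Measure.isHaarMeasure_eq_of_isProbabilityMeasure _ _

lemma continuous_integrable_haarUnitary {d : ℕ} {φ : Matrix.unitaryGroup (Fin d) ℂ → ℂ}
    (hφ : Continuous φ) : Integrable φ (haarUnitary d) :=
  hφ.integrable_of_hasCompactSupport (HasCompactSupport.of_compactSpace φ)

lemma isConjInvariant_conj {d : ℕ} (X : Matrix (Fin d) (Fin d) ℂ) :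
    IsConjInvariant (haarUnitary d)
      fun W => (W : Matrix (Fin d) (Fin d) ℂ) * X * (W : Matrix (Fin d) (Fin d) ℂ)ᴴ where
  integrable φ hφ := continuous_integrable_haarUnitary (hφ.comp (by fun_prop))
  integral_conj G hG φ _ := by
    rw [← integral_mul_left_eq_self (fun W : Matrix.unitaryGroup (Fin d) ℂ =>
      φ ((W : Matrix (Fin d) (Fin d) ℂ) * X * (W : Matrix (Fin d) (Fin d) ℂ)ᴴ)) ⟨G, hG⟩]
    simp [Matrix.mul_assoc]

lemma isConjInvariant_conj' {d : ℕ} (X : Matrix (Fin d) (Fin d) ℂ) :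
    IsConjInvariant (haarUnitary d)
      fun W => (W : Matrix (Fin d) (Fin d) ℂ)ᴴ * X * (W : Matrix (Fin d) (Fin d) ℂ) where
  integrable φ hφ := continuous_integrable_haarUnitary (hφ.comp (by fun_prop))
  integral_conj G hG φ _ := by
    have hG' : Gᴴ ∈ Matrix.unitaryGroup (Fin d) ℂ := Unitary.star_mem hG
    rw [← integral_mul_right_eq_self (fun W : Matrix.unitaryGroup (Fin d) ℂ =>
      φ ((W : Matrix (Fin d) (Fin d) ℂ)ᴴ * X * (W : Matrix (Fin d) (Fin d) ℂ))) ⟨Gᴴ, hG'⟩]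
    simp [Matrix.mul_assoc]

lemma trace_unitary_conj {d : ℕ} (X : Matrix (Fin d) (Fin d) ℂ)
    (W : Matrix.unitaryGroup (Fin d) ℂ) :
    ((W : Matrix (Fin d) (Fin d) ℂ) * X * (W : Matrix (Fin d) (Fin d) ℂ)ᴴ).trace = X.trace := by
  have h : (W : Matrix (Fin d) (Fin d) ℂ)ᴴ * W = 1 := Matrix.mem_unitaryGroup_iff'.mp W.2
  rw [Matrix.trace_mul_comm, ← Matrix.mul_assoc, h, Matrix.one_mul]

lemma trace_unitary_conj' {d : ℕ} (X : Matrix (Fin d) (Fin d) ℂ)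
    (W : Matrix.unitaryGroup (Fin d) ℂ) :
    ((W : Matrix (Fin d) (Fin d) ℂ)ᴴ * X * (W : Matrix (Fin d) (Fin d) ℂ)).trace = X.trace := by
  simpa [Matrix.star_eq_conjTranspose] using trace_unitary_conj X W⁻¹

lemma unitary_conj_mul_self {d : ℕ} (X : Matrix (Fin d) (Fin d) ℂ)
    (W : Matrix.unitaryGroup (Fin d) ℂ) :
    ((W : Matrix (Fin d) (Fin d) ℂ) * X * (W : Matrix (Fin d) (Fin d) ℂ)ᴴ) *
      ((W : Matrix (Fin d) (Fin d) ℂ) * X * (W : Matrix (Fin d) (Fin d) ℂ)ᴴ) =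
      (W : Matrix (Fin d) (Fin d) ℂ) * (X * X) * (W : Matrix (Fin d) (Fin d) ℂ)ᴴ := by
  have h : (W : Matrix (Fin d) (Fin d) ℂ)ᴴ * W = 1 := Matrix.mem_unitaryGroup_iff'.mp W.2
  simp only [Matrix.mul_assoc]
  rw [← Matrix.mul_assoc _ (W : Matrix (Fin d) (Fin d) ℂ), h, Matrix.one_mul]

lemma unitary_conj_mul_self' {d : ℕ} (X : Matrix (Fin d) (Fin d) ℂ)
    (W : Matrix.unitaryGroup (Fin d) ℂ) :
    ((W : Matrix (Fin d) (Fin d) ℂ)ᴴ * X * (W : Matrix (Fin d) (Fin d) ℂ)) *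
      ((W : Matrix (Fin d) (Fin d) ℂ)ᴴ * X * (W : Matrix (Fin d) (Fin d) ℂ)) =
      (W : Matrix (Fin d) (Fin d) ℂ)ᴴ * (X * X) * (W : Matrix (Fin d) (Fin d) ℂ) := by
  simpa [Matrix.star_eq_conjTranspose] using unitary_conj_mul_self X W⁻¹

/-! ### Permutation symmetry of the generators and the measurements -/

lemma tensorOp_mul {n : ℕ} (A B : Fin n → Matrix (Fin 2) (Fin 2) ℂ) :
    tensorOp A * tensorOp B = tensorOp fun j => A j * B j := by
  ext x y
  simp only [tensorOp, Matrix.mul_apply, Matrix.of_apply, ← Finset.prod_mul_distrib]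
  rw [Finset.prod_univ_sum, Fintype.piFinset_univ]

lemma tensorOp_conjTranspose {n : ℕ} (A : Fin n → Matrix (Fin 2) (Fin 2) ℂ) :
    (tensorOp A)ᴴ = tensorOp fun j => (A j)ᴴ := by
  ext x y
  simp [tensorOp]

/-- `R(π)` permutes the tensor factors. -/
lemma qubitRep_mul_tensorOp {n : ℕ} (π : Equiv.Perm (Fin n))
    (A : Fin n → Matrix (Fin 2) (Fin 2) ℂ) :
    qubitRep π * tensorOp A = tensorOp (A ∘ ⇑π⁻¹) * qubitRep π := by
  ext y x
  have h : ∀ z : Fin n → Fin 2, y = z ∘ ⇑π⁻¹ ↔ z = y ∘ ⇑π := by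
    intro z
    constructor <;> rintro rfl <;> funext j <;> simp
  simp only [qubitRep, tensorOp, Matrix.mul_apply, Matrix.of_apply, h, ite_mul, one_mul, zero_mul,
    mul_ite, mul_one, mul_zero, Finset.sum_ite_eq', Finset.mem_univ, if_true]
  rw [← Equiv.prod_comp π⁻¹]
  simp

lemma qubitRep_mul_onQubit {n : ℕ} (π : Equiv.Perm (Fin n)) (j : Fin n)
    (χ : Matrix (Fin 2) (Fin 2) ℂ) :
    qubitRep π * onQubit j χ = onQubit (π j) χ * qubitRep π := by
  rw [onQubit, qubitRep_mul_tensorOp, onQubit]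
  congr 2
  funext k
  by_cases h : k = π j
  · subst h
    simp
  · have : π⁻¹ k ≠ j := fun h' => h (by simp [← h'])
    simp only [Function.comp_apply, Function.update_of_ne h, Function.update_of_ne this]

lemma qubitRep_conjTranspose {n : ℕ} (π : Equiv.Perm (Fin n)) :
    (qubitRep π)ᴴ = qubitRep π⁻¹ := by
  ext y x
  have h : x = y ∘ ⇑π⁻¹ ↔ y = x ∘ ⇑(π⁻¹)⁻¹ := by
    constructor <;> rintro rfl <;> funext j <;> simp
  simp only [qubitRep, Matrix.conjTranspose_apply, Matrix.of_apply, h]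
  split_ifs <;> simp

/-- `B` commutes with the qubit-defining representation. -/
def IsEquivariant {n : ℕ} (B : Op n) : Prop := ∀ π, Commute (qubitRep π) B

namespace IsEquivariant

variable {n : ℕ} {B C : Op n}

lemma mul (hB : IsEquivariant B) (hC : IsEquivariant C) : IsEquivariant (B * C) :=
  fun π => (hB π).mul_right (hC π)

lemma sub (hB : IsEquivariant B) (hC : IsEquivariant C) : IsEquivariant (B - C) :=
  fun π => (hB π).sub_right (hC π)

lemma smul (hB : IsEquivariant B) (a : ℂ) : IsEquivariant (a • B) :=
  fun π => (hB π).smul_right a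

lemma conjTranspose (hB : IsEquivariant B) : IsEquivariant Bᴴ := fun π => by
  have h := congrArg Matrix.conjTranspose (hB π⁻¹).eq
  rw [Matrix.conjTranspose_mul, Matrix.conjTranspose_mul, qubitRep_conjTranspose, inv_inv] at h
  exact h.symm

lemma list_prod {l : List (Op n)} (h : ∀ A ∈ l, IsEquivariant A) : IsEquivariant l.prod :=
  fun π => Commute.list_prod_right _ _ fun A hA => h A hA π

open scoped Matrix.Norms.Operator in
lemma exp (hB : IsEquivariant B) : IsEquivariant (NormedSpace.exp B) :=
  fun π => (hB π).exp_right

end IsEquivariant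

lemma onQubit_commute {n : ℕ} (j k : Fin n) (χ : Matrix (Fin 2) (Fin 2) ℂ) :
    Commute (onQubit j χ) (onQubit k χ) := by
  rw [Commute, SemiconjBy, onQubit, onQubit, tensorOp_mul, tensorOp_mul]
  congr 1
  funext l
  simp only [Function.update_apply]
  split_ifs <;> simp

/-- The sum over pairs `k < j` is half of the sum over `k ≠ j`, which is visibly invariant under
permutations of the qubits. -/
lemma two_smul_sum_pairs {n : ℕ} (χ : Matrix (Fin 2) (Fin 2) ℂ) :
    (2 : ℂ) • ∑ j : Fin n, ∑ k ∈ Finset.univ.filter (· < j), onQubit j χ * onQubit k χ =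
      ∑ j : Fin n, ∑ k : Fin n, if k = j then 0 else onQubit j χ * onQubit k χ := by
  have h1 : ∀ j k : Fin n, (if k = j then 0 else onQubit j χ * onQubit k χ) =
      (if k < j then onQubit j χ * onQubit k χ else 0) +
        (if j < k then onQubit k χ * onQubit j χ else 0) := by
    intro j k
    rcases lt_trichotomy k j with h | h | h
    · simp [h, h.ne, h.not_gt]
    · simp [h]
    · simp [h, h.ne', h.not_gt, (onQubit_commute j k χ).eq]
  simp only [h1, Finset.sum_add_distrib, Finset.sum_filter]
  rw [two_smul]
  congr 1
  rw [Finset.sum_comm]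

lemma oneBody_equivariant (n : ℕ) (χ : Matrix (Fin 2) (Fin 2) ℂ) :
    IsEquivariant (oneBody n χ) := fun π => by
  refine Commute.smul_right ?_ _
  rw [Commute, SemiconjBy, Finset.mul_sum, Finset.sum_mul]
  simp only [qubitRep_mul_onQubit]
  exact Equiv.sum_comp π fun j => onQubit j χ * qubitRep π

lemma twoBody_eq (n : ℕ) (χ : Matrix (Fin 2) (Fin 2) ℂ) :
    twoBody n χ = (1 / ((n : ℂ) * ((n : ℂ) - 1))) •
      ∑ j : Fin n, ∑ k : Fin n, if k = j then 0 else onQubit j χ * onQubit k χ := by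
  rw [twoBody, ← two_smul_sum_pairs, smul_smul]
  congr 1
  ring

lemma twoBody_equivariant (n : ℕ) (χ : Matrix (Fin 2) (Fin 2) ℂ) :
    IsEquivariant (twoBody n χ) := fun π => by
  rw [twoBody_eq]
  refine Commute.smul_right ?_ _
  rw [Commute, SemiconjBy, Finset.mul_sum, Finset.sum_mul]
  rw [← Equiv.sum_comp π fun j =>
    (∑ k : Fin n, if k = j then 0 else onQubit j χ * onQubit k χ) * qubitRep π]
  refine Finset.sum_congr rfl fun j _ => ?_
  rw [Finset.mul_sum, Finset.sum_mul]
  rw [← Equiv.sum_comp π fun k =>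
    (if k = π j then 0 else onQubit (π j) χ * onQubit k χ) * qubitRep π]
  refine Finset.sum_congr rfl fun k _ => ?_
  by_cases h : k = j
  · simp [h]
  · simp only [h, EmbeddingLike.apply_eq_iff_eq, if_false]
    rw [← Matrix.mul_assoc, qubitRep_mul_onQubit, Matrix.mul_assoc, qubitRep_mul_onQubit,
      ← Matrix.mul_assoc]

lemma onQubit_isHermitian {n : ℕ} (j : Fin n) {χ : Matrix (Fin 2) (Fin 2) ℂ}
    (hχ : χ.IsHermitian) : (onQubit j χ).IsHermitian := by
  rw [Matrix.IsHermitian, onQubit, tensorOp_conjTranspose]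
  congr 1
  funext l
  simp only [Function.update_apply]
  split_ifs
  · exact hχ
  · simp

lemma oneBody_isHermitian (n : ℕ) {χ : Matrix (Fin 2) (Fin 2) ℂ} (hχ : χ.IsHermitian) :
    (oneBody n χ).IsHermitian := by
  rw [Matrix.IsHermitian, oneBody, Matrix.conjTranspose_smul, Matrix.conjTranspose_sum]
  simp [(onQubit_isHermitian _ hχ).eq]

lemma twoBody_isHermitian (n : ℕ) {χ : Matrix (Fin 2) (Fin 2) ℂ} (hχ : χ.IsHermitian) :
    (twoBody n χ).IsHermitian := by
  rw [Matrix.IsHermitian, twoBody, Matrix.conjTranspose_smul, Matrix.conjTranspose_sum]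
  simp [Matrix.conjTranspose_sum, Matrix.conjTranspose_mul, (onQubit_isHermitian _ hχ).eq,
    (onQubit_commute _ _ χ).eq]

lemma pauliX_isHermitian : pauliX.IsHermitian := by
  ext i j
  fin_cases i <;> fin_cases j <;> simp [pauliX]

lemma pauliY_isHermitian : pauliY.IsHermitian := by
  ext i j
  fin_cases i <;> fin_cases j <;> simp [pauliY]

lemma pauliZ_isHermitian : pauliZ.IsHermitian := by
  ext i j
  fin_cases i <;> fin_cases j <;> simp [pauliZ]

lemma equivariant_of_mem_generators {n : ℕ} {A : Op n} (h : A ∈ generators n) :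
    IsEquivariant A := by
  rcases h with rfl | rfl | rfl
  exacts [oneBody_equivariant n _, oneBody_equivariant n _, twoBody_equivariant n _]

lemma isHermitian_of_mem_generators {n : ℕ} {A : Op n} (h : A ∈ generators n) :
    A.IsHermitian := by
  rcases h with rfl | rfl | rfl
  exacts [oneBody_isHermitian n pauliX_isHermitian, oneBody_isHermitian n pauliY_isHermitian,
    twoBody_isHermitian n pauliZ_isHermitian]

lemma equivariant_of_mem_measurements {n : ℕ} {A : Op n} (h : A ∈ measurements n) :
    IsEquivariant A := by
  rcases h with rfl | rfl | rfl
  exacts [oneBody_equivariant n _, twoBody_equivariant n _, fun π => qubitRep_mul_tensorOp π _]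

lemma isHermitian_of_mem_measurements {n : ℕ} {A : Op n} (h : A ∈ measurements n) :
    A.IsHermitian := by
  rcases h with rfl | rfl | rfl
  · exact oneBody_isHermitian n pauliX_isHermitian
  · exact twoBody_isHermitian n pauliX_isHermitian
  · rw [Matrix.IsHermitian, tensorOp_conjTranspose, pauliX_isHermitian.eq]

/-! ### Block structure of equivariant operators -/

namespace IsotypicDecomposition

variable {n : ℕ} {Λ : Type} [Fintype Λ] (D : IsotypicDecomposition n Λ)

lemma Q_mul_qubitRep (lam : Λ) (ν : Fin (D.m lam)) (π : Equiv.Perm (Fin n)) :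
    D.Q lam ν * qubitRep π =
      ∑ κ, LinearMap.toMatrix' (D.r lam π) ν κ • D.Q lam κ := by
  classical
  rw [D.decomposition π, Matrix.mul_sum, Finset.sum_eq_single lam]
  · rw [Matrix.mul_sum, Finset.sum_eq_single ν]
    · simp [Matrix.mul_sum, ← Matrix.mul_assoc, D.orthonormal_same]
    · intro κ _ hκ
      simp [Matrix.mul_sum, ← Matrix.mul_assoc, D.orthogonal_copies lam ν κ hκ.symm]
    · simp
  · intro lam' _ h
    simp [Matrix.mul_sum, ← Matrix.mul_assoc, D.orthogonal_irreps lam lam' ν _ h.symm]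
  · simp

lemma qubitRep_mul_Q (lam : Λ) (ν : Fin (D.m lam)) (π : Equiv.Perm (Fin n)) :
    qubitRep π * (D.Q lam ν)ᴴ =
      ∑ κ, LinearMap.toMatrix' (D.r lam π) κ ν • (D.Q lam κ)ᴴ := by
  classical
  rw [D.decomposition π, Matrix.sum_mul, Finset.sum_eq_single lam]
  · rw [Matrix.sum_mul]
    refine Finset.sum_congr rfl fun κ _ => ?_
    rw [Matrix.sum_mul, Finset.sum_eq_single ν]
    · simp [Matrix.mul_assoc, D.orthonormal_same]
    · intro κ _ hκ
      simp [Matrix.mul_assoc, D.orthogonal_copies lam κ ν hκ]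
    · simp
  · intro lam' _ h
    simp [Matrix.sum_mul, Matrix.mul_assoc, D.orthogonal_irreps lam' lam _ ν h]
  · simp

/-- The entries at a fixed position of all the blocks `Q_λ^ν B (Q_λ'^ν')†` of an equivariant
operator, which form an intertwining map from `r_λ'` to `r_λ`. -/
def blockIntertwiner {B : Op n} (hB : IsEquivariant B) (lam lam' : Λ) (i : Fin (D.d lam))
    (j : Fin (D.d lam')) : (D.r lam').IntertwiningMap (D.r lam) where
  toLinearMap := Matrix.toLin' (Matrix.of fun ν ν' => (D.Q lam ν * B * (D.Q lam' ν')ᴴ) i j)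
  isIntertwining' π := by
    apply LinearMap.toMatrix'.injective
    rw [LinearMap.toMatrix'_comp, LinearMap.toMatrix'_comp, LinearMap.toMatrix'_toLin']
    ext ν ν'
    have h : D.Q lam ν * B * (qubitRep π * (D.Q lam' ν')ᴴ) =
        (D.Q lam ν * qubitRep π) * B * (D.Q lam' ν')ᴴ := by
      simp only [Matrix.mul_assoc]
      rw [← Matrix.mul_assoc B, ← (hB π).eq, Matrix.mul_assoc]
    rw [Q_mul_qubitRep, qubitRep_mul_Q, Matrix.mul_sum, Matrix.sum_mul, Matrix.sum_mul] at h
    have h' := congrFun (congrFun h i) j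
    simpa [Matrix.mul_apply (M := Matrix.of _), Matrix.mul_apply (N := Matrix.of _),
      Matrix.sum_apply, mul_comm] using h'

lemma blockIntertwiner_apply_single {B : Op n} (hB : IsEquivariant B) (lam lam' : Λ)
    (i : Fin (D.d lam)) (j : Fin (D.d lam')) (ν : Fin (D.m lam)) (ν' : Fin (D.m lam')) :
    (D.blockIntertwiner hB lam lam' i j).toLinearMap (Pi.single ν' 1) ν =
      (D.Q lam ν * B * (D.Q lam' ν')ᴴ) i j := by
  simp [blockIntertwiner]

/-- Schur's lemma for inequivalent irreducible representations. -/
lemma block_eq_zero_of_ne {B : Op n} (hB : IsEquivariant B) {lam lam' : Λ} (h : lam ≠ lam')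
    (ν : Fin (D.m lam)) (ν' : Fin (D.m lam')) : D.Q lam ν * B * (D.Q lam' ν')ᴴ = 0 := by
  ext i j
  have := D.irreducible lam
  have := D.irreducible lam'
  have := D.inequivalent lam' lam h.symm
  rw [← D.blockIntertwiner_apply_single hB,
    Subsingleton.elim (D.blockIntertwiner hB lam lam' i j) 0]
  simp

/-- Schur's lemma for one irreducible representation: the blocks between its copies form a scalar
matrix, for each position `(i, j)` in the block. -/
lemma exists_block_eq {B : Op n} (hB : IsEquivariant B) (lam : Λ) (i j : Fin (D.d lam)) :
    ∃ a : ℂ, ∀ ν ν', (D.Q lam ν * B * (D.Q lam ν')ᴴ) i j = if ν = ν' then a else 0 := by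
  have := D.irreducible lam
  obtain ⟨a, ha⟩ := (Representation.IsIrreducible.algebraMap_intertwiningMap_bijective_of_isAlgClosed
    (ρ := D.r lam)).2 (D.blockIntertwiner hB lam lam i j)
  refine ⟨a, fun ν ν' => ?_⟩
  rw [← D.blockIntertwiner_apply_single hB, ← ha]
  simp [Pi.single_apply, Representation.IntertwiningMap.toLinearMap_apply]

lemma block_eq_zero_of_copy_ne {B : Op n} (hB : IsEquivariant B) {lam : Λ}
    {ν ν' : Fin (D.m lam)} (h : ν ≠ ν') : D.Q lam ν * B * (D.Q lam ν')ᴴ = 0 := by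
  ext i j
  obtain ⟨a, ha⟩ := D.exists_block_eq hB lam i j
  simp [ha, h]

/-- The block of an equivariant operator does not depend on the copy of the irreducible
representation. -/
lemma restrict_eq {B : Op n} (hB : IsEquivariant B) (lam : Λ) (ν ν' : Fin (D.m lam)) :
    D.restrict lam ν B = D.restrict lam ν' B := by
  ext i j
  obtain ⟨a, ha⟩ := D.exists_block_eq hB lam i j
  simp [restrict, ha]

/-- Restriction to a block is multiplicative as soon as the left factor is equivariant. -/
lemma restrict_mul {B : Op n} (hB : IsEquivariant B) (C : Op n) (lam : Λ) (ν : Fin (D.m lam)) :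
    D.restrict lam ν (B * C) = D.restrict lam ν B * D.restrict lam ν C := by
  have h : D.restrict lam ν (B * C) = ∑ lam', ∑ ν', D.Q lam ν * B * (D.Q lam' ν')ᴴ *
      (D.Q lam' ν' * C * (D.Q lam ν)ᴴ) := by
    calc D.restrict lam ν (B * C)
        = D.Q lam ν * B * (∑ lam', ∑ ν', (D.Q lam' ν')ᴴ * D.Q lam' ν') * C * (D.Q lam ν)ᴴ := by
          simp [D.complete, restrict, Matrix.mul_assoc]
      _ = _ := by simp [Matrix.mul_sum, Matrix.sum_mul, Matrix.mul_assoc]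
  rw [h, Finset.sum_eq_single lam, Finset.sum_eq_single ν]
  · rfl
  · intro κ _ hκ
    rw [D.block_eq_zero_of_copy_ne hB hκ.symm, Matrix.zero_mul]
  · simp
  · intro lam' _ h'
    refine Finset.sum_eq_zero fun κ _ => ?_
    rw [D.block_eq_zero_of_ne hB h'.symm, Matrix.zero_mul]
  · simp

lemma restrict_conjTranspose (B : Op n) (lam : Λ) (ν : Fin (D.m lam)) :
    D.restrict lam ν Bᴴ = (D.restrict lam ν B)ᴴ := by
  simp [restrict, Matrix.conjTranspose_mul, Matrix.mul_assoc]

lemma restrict_sub (B C : Op n) (lam : Λ) (ν : Fin (D.m lam)) :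
    D.restrict lam ν (B - C) = D.restrict lam ν B - D.restrict lam ν C := by
  simp [restrict, Matrix.mul_sub, Matrix.sub_mul]

lemma restrict_smul (a : ℂ) (B : Op n) (lam : Λ) (ν : Fin (D.m lam)) :
    D.restrict lam ν (a • B) = a • D.restrict lam ν B := by
  simp [restrict]

lemma continuous_restrict (lam : Λ) (ν : Fin (D.m lam)) : Continuous (D.restrict lam ν) := by
  unfold restrict
  fun_prop

/-- The expectation value of an equivariant operator `B` sees the state `S` only through the sums
over the copies of its blocks. -/
lemma trace_mul_eq_sum (copy : (lam : Λ) → Fin (D.m lam)) {B : Op n} (hB : IsEquivariant B)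
    (S : Op n) : (B * S).trace =
      ∑ lam, (D.restrict lam (copy lam) B * ∑ ν, D.restrict lam ν S).trace := by
  have h : (B * S).trace = ∑ lam, ∑ ν, (D.restrict lam ν (B * S)).trace := by
    calc (B * S).trace = ((∑ lam, ∑ ν, (D.Q lam ν)ᴴ * D.Q lam ν) * (B * S)).trace := by
          rw [D.complete, Matrix.one_mul]
      _ = _ := by
          simp only [Matrix.sum_mul, Matrix.trace_sum, restrict]
          refine Finset.sum_congr rfl fun lam _ => Finset.sum_congr rfl fun ν _ => ?_
          rw [Matrix.mul_assoc, Matrix.trace_mul_comm]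
  rw [h]
  refine Finset.sum_congr rfl fun lam _ => ?_
  rw [Matrix.mul_sum, Matrix.trace_sum]
  refine Finset.sum_congr rfl fun ν _ => ?_
  rw [D.restrict_mul hB, D.restrict_eq hB lam ν (copy lam)]

end IsotypicDecomposition

/-! ### The layered circuit -/

/-- A strictly increasing list is cut by a downward closed condition into the elements that satisfy
it, followed by those that do not. -/
lemma pairwise_lt_eq_filter_append {α : Type*} [LinearOrder α] (p : α → Bool)
    (hp : ∀ a b, a < b → p b = true → p a = true) (l : List α) (hl : l.Pairwise (· < ·)) :
    l = l.filter p ++ l.filter fun a => !p a := by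
  induction l with
  | nil => simp
  | cons a l ih =>
    rw [List.pairwise_cons] at hl
    by_cases h : p a = true
    · simpa [h] using ih hl.2
    · have h' : ∀ b ∈ l, p b = false := fun b hb => by
        by_contra hpb
        exact h (hp a b (hl.1 b hb) (by simpa using hpb))
      rw [List.filter_eq_nil_iff.mpr, List.filter_eq_self.mpr, List.nil_append]
      · simpa [h] using h'
      · simpa [h] using h'

section Layers

variable {n L : ℕ} (H : Fin L → Op n)

lemma layers_congr (p : Fin L → Prop) [DecidablePred p] {θ θ' : Fin L → ℝ}
    (h : ∀ l, p l → θ l = θ' l) : layers H p θ = layers H p θ' := by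
  unfold layers
  congr 1
  refine List.map_congr_left fun l hl => ?_
  rw [h l (by simpa using hl)]

lemma layers_congr_pred {p q : Fin L → Prop} [DecidablePred p] [DecidablePred q]
    (h : ∀ l, p l ↔ q l) (θ : Fin L → ℝ) : layers H p θ = layers H q θ := by
  obtain rfl : p = q := funext fun l => propext (h l)
  congr

/-- A downward closed condition `q` splits the layers; those with `q` act first. -/
lemma layers_split (p q : Fin L → Prop) [DecidablePred p] [DecidablePred q]
    (hq : ∀ a b, a < b → q b → q a) (θ : Fin L → ℝ) :
    layers H p θ = layers H (fun l => p l ∧ ¬q l) θ * layers H (fun l => p l ∧ q l) θ := by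
  unfold layers
  rw [← List.prod_append, ← List.map_append, ← List.reverse_append]
  congr 3
  rw [pairwise_lt_eq_filter_append (fun l => decide (q l)) (by simpa using hq)
    ((List.finRange L).filter fun l => decide (p l))
    ((List.pairwise_lt_finRange L).filter _), List.filter_filter, List.filter_filter]
  simp [Bool.and_comm]

lemma layers_eq_single (μ : Fin L) (p : Fin L → Prop) [DecidablePred p] (hp : ∀ l, p l ↔ l = μ)
    (θ : Fin L → ℝ) :
    layers H p θ = NormedSpace.exp ((-(Complex.I * (θ μ : ℂ))) • H μ) := by
  have h : ((List.finRange L).filter fun l => decide (p l)) = [μ] := by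
    have h1 : (fun l => decide (p l)) = fun l => l == μ := by
      funext l
      rw [Bool.eq_iff_iff]
      simp [hp]
    rw [h1, List.filter_beq, List.count_eq_one_of_mem (List.nodup_finRange L) (List.mem_finRange μ)]
    rfl
  simp [layers, h]

lemma circuit_eq_circuitPart_mul (μ : Fin L) (θ : Fin L → ℝ) :
    circuit H θ = circuitPart H μ true θ * circuitPart H μ false θ := by
  rw [circuit, layers_split H _ (fun l => l ≤ μ) (fun a b h h' => h.le.trans h') θ]
  exact congrArg₂ (· * ·) (layers_congr_pred H (by simp) θ) (layers_congr_pred H (by simp) θ)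

/-- The layer `μ` is the last one in `U_B`. -/
lemma circuitPart_false_eq (μ : Fin L) (θ : Fin L → ℝ) :
    circuitPart H μ false θ =
      NormedSpace.exp ((-(Complex.I * (θ μ : ℂ))) • H μ) * layers H (fun l => l < μ) θ := by
  rw [circuitPart, layers_split H _ (fun l => l < μ) (fun a b h h' => h.trans h') θ,
    layers_eq_single H μ (fun l => l ≤ μ ∧ ¬l < μ)
      (fun l => by rw [not_lt]; exact ⟨fun h => le_antisymm h.1 h.2, fun h => by simp [h]⟩)]
  exact congrArg _ (layers_congr_pred H (fun l => ⟨fun h => h.2, fun h => ⟨h.le, h⟩⟩) θ)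

variable {H}

lemma layers_equivariant (hH : ∀ l, IsEquivariant (H l)) (p : Fin L → Prop) [DecidablePred p]
    (θ : Fin L → ℝ) : IsEquivariant (layers H p θ) := by
  refine IsEquivariant.list_prod fun A hA => ?_
  obtain ⟨l, -, rfl⟩ := List.mem_map.mp hA
  exact ((hH l).smul _).exp

lemma exp_mem_unitaryGroup {A : Op n} (hA : A.IsHermitian) (t : ℝ) :
    NormedSpace.exp ((-(Complex.I * (t : ℂ))) • A) ∈ Matrix.unitaryGroup (Fin n → Fin 2) ℂ := by
  have h : ((-(Complex.I * (t : ℂ))) • A)ᴴ = (Complex.I * (t : ℂ)) • A := by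
    rw [Matrix.conjTranspose_smul, hA.eq]
    simp
  rw [Matrix.mem_unitaryGroup_iff', Matrix.star_eq_conjTranspose, ← Matrix.exp_conjTranspose, h,
    ← Matrix.exp_add_of_commute _ _ (((Commute.refl A).smul_left _).smul_right _), ← add_smul]
  simp

lemma layers_mem_unitaryGroup (hH : ∀ l, (H l).IsHermitian) (p : Fin L → Prop) [DecidablePred p]
    (θ : Fin L → ℝ) : layers H p θ ∈ Matrix.unitaryGroup (Fin n → Fin 2) ℂ := by
  refine Submonoid.list_prod_mem _ fun A hA => ?_
  obtain ⟨l, -, rfl⟩ := List.mem_map.mp hA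
  exact exp_mem_unitaryGroup (hH l) (θ l)

open scoped Matrix.Norms.Operator in
lemma continuous_layers (p : Fin L → Prop) [DecidablePred p] : Continuous (layers H p) := by
  unfold layers
  refine continuous_list_prod _ fun l _ => ?_
  exact NormedSpace.exp_continuous.comp (by fun_prop)

lemma circuitPart_equivariant (hH : ∀ l, IsEquivariant (H l)) (μ : Fin L) (b : Bool)
    (θ : Fin L → ℝ) : IsEquivariant (circuitPart H μ b θ) := by
  cases b <;> exact layers_equivariant hH _ θ

lemma circuitPart_mem_unitaryGroup (hH : ∀ l, (H l).IsHermitian) (μ : Fin L) (b : Bool)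
    (θ : Fin L → ℝ) : circuitPart H μ b θ ∈ Matrix.unitaryGroup (Fin n → Fin 2) ℂ := by
  cases b <;> exact layers_mem_unitaryGroup hH _ θ

lemma continuous_circuitPart (μ : Fin L) (b : Bool) : Continuous (circuitPart H μ b) := by
  cases b <;> exact continuous_layers _

lemma isCompact_unitaryGroup (ι : Type*) [Fintype ι] [DecidableEq ι] :
    IsCompact (Matrix.unitaryGroup ι ℂ : Set (Matrix ι ι ℂ)) := by
  have hsub : (Matrix.unitaryGroup ι ℂ : Set (Matrix ι ι ℂ)) ⊆
      Set.univ.pi fun _ => Set.univ.pi fun _ => Metric.closedBall (0 : ℂ) 1 := by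
    intro U hU i _ j _
    simpa using entry_norm_bound_of_unitary hU i j
  have hcompact : IsCompact (Set.univ.pi fun _ : ι => Set.univ.pi fun _ : ι =>
      Metric.closedBall (0 : ℂ) 1) :=
    isCompact_univ_pi fun _ => isCompact_univ_pi fun _ => isCompact_closedBall _ _
  exact hcompact.of_isClosed_subset (isClosed_unitary (R := Matrix ι ι ℂ)) hsub

/-- Continuous functions of the two parts of the circuit are bounded, by compactness of the unitary
group, and therefore lie in every `L^p`. -/
lemma memLp_circuitPart (hH : ∀ l, (H l).IsHermitian) (μ : Fin L) (P : Measure (Fin L → ℝ))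
    [IsFiniteMeasure P] (p : ENNReal) (Φ : Op n × Op n → ℂ) (hΦ : Continuous Φ) :
    MemLp (fun θ => Φ (circuitPart H μ true θ, circuitPart H μ false θ)) p P := by
  have hK := (isCompact_unitaryGroup (Fin n → Fin 2)).prod (isCompact_unitaryGroup (Fin n → Fin 2))
  obtain ⟨C, hC⟩ := hK.exists_bound_of_continuousOn hΦ.continuousOn
  refine MemLp.of_bound ?_ C (Filter.Eventually.of_forall fun θ => hC _
    ⟨circuitPart_mem_unitaryGroup hH μ true θ, circuitPart_mem_unitaryGroup hH μ false θ⟩)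
  exact (hΦ.comp ((continuous_circuitPart μ true).prodMk
    (continuous_circuitPart μ false))).aestronglyMeasurable

end Layers

/-! ### The partial derivative of the loss -/

/-- The observable `i [H, A† O A]`, whose expectation value is the derivative of the loss in the
angle of the generator `H`, when `A` is the part of the circuit after it. -/
def commutatorObs {ι : Type*} [Fintype ι] (H O A : Matrix ι ι ℂ) : Matrix ι ι ℂ :=
  Complex.I • (H * (Aᴴ * O * A) - Aᴴ * O * A * H)

lemma commutatorObs_isHermitian {ι : Type*} [Fintype ι] {H O : Matrix ι ι ℂ}
    (hH : H.IsHermitian) (hO : O.IsHermitian) (A : Matrix ι ι ℂ) :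
    (commutatorObs H O A).IsHermitian := by
  rw [Matrix.IsHermitian, commutatorObs, Matrix.conjTranspose_smul, Matrix.conjTranspose_sub]
  simp only [Matrix.conjTranspose_mul, Matrix.conjTranspose_conjTranspose, hH.eq, hO.eq,
    Matrix.mul_assoc]
  rw [← neg_sub, smul_neg, ← neg_smul]
  simp

/-- The derivative of the empirical loss with respect to `θ_μ`, written as the expectation value of
`i [H_μ, U_A† O U_A]` in the state `U_B S U_B†`. -/
def lossGradient {n L : ℕ} (H : Fin L → Op n) (O S : Op n) (μ : Fin L) (θ : Fin L → ℝ) : ℂ :=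
  (commutatorObs (H μ) O (circuitPart H μ true θ) *
    (circuitPart H μ false θ * S * (circuitPart H μ false θ)ᴴ)).trace

lemma empiricalLoss_eq {n L M : ℕ} (H : Fin L → Op n) (O : Op n) (c : Fin M → ℝ)
    (ρ : Fin M → Op n) (θ : Fin L → ℝ) :
    empiricalLoss H O c ρ θ =
      (circuit H θ * (∑ i, (c i : ℂ) • ρ i) * (circuit H θ)ᴴ * O).trace.re := by
  simp [empiricalLoss, loss, Matrix.mul_sum, Matrix.sum_mul, Matrix.trace_sum]

open scoped Matrix.Norms.Operator in
/-- Differentiating `Tr[(A e^{-itH} B) S (A e^{-itH} B)† O]` gives the expectation value of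
`i [H, A† O A]`. The adjoint of `e^{-itH}` is written as `e^{itH}`. -/
lemma hasDerivAt_trace_conj_exp {ι : Type*} [Fintype ι] [DecidableEq ι] (A B S O H : Matrix ι ι ℂ)
    (t : ℝ) :
    HasDerivAt (fun t : ℝ => (A * NormedSpace.exp (t • (-Complex.I • H)) * B * S *
      (Bᴴ * NormedSpace.exp (t • (Complex.I • H)) * Aᴴ) * O).trace)
      (commutatorObs H O A * (NormedSpace.exp (t • (-Complex.I • H)) * B * S *
        (Bᴴ * NormedSpace.exp (t • (Complex.I • H))))).trace t := by
  have h1 : HasDerivAt (fun u : ℝ => NormedSpace.exp (u • (-Complex.I • H)))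
      (-Complex.I • H * NormedSpace.exp (t • (-Complex.I • H))) t :=
    hasDerivAt_exp_smul_const' _ t
  have h2 : HasDerivAt (fun u : ℝ => NormedSpace.exp (u • (Complex.I • H)))
      (NormedSpace.exp (t • (Complex.I • H)) * Complex.I • H) t :=
    hasDerivAt_exp_smul_const _ t
  have h3 := ((((h1.const_mul A).mul_const B).mul_const S).mul
    ((h2.const_mul Bᴴ).mul_const Aᴴ)).mul_const O
  have h4 := (LinearMap.toContinuousLinearMap
    ((Matrix.traceLinearMap ι ℂ ℂ).restrictScalars ℝ)).hasFDerivAt.comp_hasDerivAt t h3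
  refine HasDerivAt.congr_deriv h4 ?_
  change Matrix.trace _ = _
  rw [commutatorObs]
  generalize NormedSpace.exp (t • (-Complex.I • H)) = E
  generalize NormedSpace.exp (t • (Complex.I • H)) = E'
  have e1 : (H * (Aᴴ * O * A) * (E * B * S * (Bᴴ * E'))).trace =
      (A * E * B * S * (Bᴴ * (E' * H) * Aᴴ) * O).trace := by
    have h := Matrix.trace_mul_comm (H * (Aᴴ * O)) (A * (E * B * S * (Bᴴ * E')))
    simp only [Matrix.mul_assoc] at h ⊢
    rw [h]
  have e2 : (Aᴴ * O * A * H * (E * B * S * (Bᴴ * E'))).trace =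
      (A * (H * E) * B * S * (Bᴴ * E' * Aᴴ) * O).trace := by
    have h := Matrix.trace_mul_comm (Aᴴ * O) (A * H * (E * B * S * (Bᴴ * E')))
    simp only [Matrix.mul_assoc] at h ⊢
    rw [h]
  simp only [Matrix.smul_mul, Matrix.mul_smul, Matrix.add_mul,
    Matrix.sub_mul, Matrix.trace_add, Matrix.trace_sub, Matrix.trace_smul, smul_eq_mul, e1, e2]
  ring

lemma circuitPart_false_eq_real_smul {n L : ℕ} (H : Fin L → Op n) (μ : Fin L) (θ : Fin L → ℝ) :
    circuitPart H μ false θ =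
      NormedSpace.exp (θ μ • (-Complex.I • H μ)) * layers H (fun l => l < μ) θ := by
  rw [circuitPart_false_eq, ← Complex.coe_smul, smul_smul]
  congr 3
  ring

lemma exp_smul_conjTranspose {n : ℕ} {A : Op n} (hA : A.IsHermitian) (t : ℝ) :
    (NormedSpace.exp (t • (-Complex.I • A)))ᴴ = NormedSpace.exp (t • (Complex.I • A)) := by
  rw [← Matrix.exp_conjTranspose, Matrix.conjTranspose_smul, Matrix.conjTranspose_smul, hA.eq]
  simp

lemma hasDerivAt_trace_circuit {n L : ℕ} {H : Fin L → Op n} (O S : Op n) (μ : Fin L)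
    (hH : (H μ).IsHermitian) (θ : Fin L → ℝ) :
    HasDerivAt (fun t : ℝ => (circuit H (Function.update θ μ t) * S *
      (circuit H (Function.update θ μ t))ᴴ * O).trace) (lossGradient H O S μ θ) (θ μ) := by
  have hcirc : ∀ t : ℝ, circuit H (Function.update θ μ t) = circuitPart H μ true θ *
      NormedSpace.exp (t • (-Complex.I • H μ)) * layers H (fun l => l < μ) θ := by
    intro t
    have h1 : circuitPart H μ true (Function.update θ μ t) = circuitPart H μ true θ :=
      layers_congr H (fun l => μ < l) fun l hl => Function.update_of_ne hl.ne' _ _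
    have h2 : layers H (fun l => l < μ) (Function.update θ μ t) = layers H (fun l => l < μ) θ :=
      layers_congr H _ fun l hl => Function.update_of_ne hl.ne _ _
    rw [circuit_eq_circuitPart_mul H μ, circuitPart_false_eq_real_smul, h1, h2, Function.update_self,
      Matrix.mul_assoc]
  have h := hasDerivAt_trace_conj_exp (circuitPart H μ true θ) (layers H (fun l => l < μ) θ) S O
    (H μ) (θ μ)
  simpa only [hcirc, lossGradient, circuitPart_false_eq_real_smul, Matrix.conjTranspose_mul,
    exp_smul_conjTranspose hH, Matrix.mul_assoc] using h

lemma hasDerivAt_empiricalLoss {n L M : ℕ} {H : Fin L → Op n} (O : Op n) (c : Fin M → ℝ)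
    (ρ : Fin M → Op n) (μ : Fin L) (hH : (H μ).IsHermitian) (θ : Fin L → ℝ) :
    HasDerivAt (fun t : ℝ => empiricalLoss H O c ρ (Function.update θ μ t))
      (lossGradient H O (∑ i, (c i : ℂ) • ρ i) μ θ).re (θ μ) := by
  simp only [empiricalLoss_eq]
  exact Complex.reCLM.hasFDerivAt.comp_hasDerivAt (θ μ) (hasDerivAt_trace_circuit O _ μ hH θ)

/-- The derivative of the empirical loss is real: it is the trace of a product of two Hermitian
operators. -/
lemma partialDeriv_empiricalLoss {n L M : ℕ} {H : Fin L → Op n} {O : Op n} (c : Fin M → ℝ)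
    {ρ : Fin M → Op n} (μ : Fin L) (hH : (H μ).IsHermitian) (hO : O.IsHermitian)
    (hρ : ∀ i, (ρ i).IsHermitian) (θ : Fin L → ℝ) :
    ((partialDeriv (empiricalLoss H O c ρ) μ θ : ℝ) : ℂ) =
      lossGradient H O (∑ i, (c i : ℂ) • ρ i) μ θ := by
  rw [partialDeriv, (hasDerivAt_empiricalLoss O c ρ μ hH θ).deriv]
  refine Complex.conj_eq_iff_re.mp ?_
  rw [starRingEnd_apply, lossGradient, ← Matrix.trace_conjTranspose, Matrix.conjTranspose_mul,
    (commutatorObs_isHermitian hH hO _).eq, Matrix.trace_mul_comm]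
  congr 2
  simp [Matrix.conjTranspose_mul, Matrix.conjTranspose_sum, (hρ _).eq, Matrix.mul_assoc]

/-! ### Haar moments of the conjugated commutator -/

lemma commutatorObs_trace {d : ℕ} (H O W : Matrix (Fin d) (Fin d) ℂ) :
    (commutatorObs H O W).trace = 0 := by
  rw [commutatorObs, Matrix.trace_smul, Matrix.trace_sub, Matrix.trace_mul_comm H]
  simp

lemma continuous_commutatorObs {ι : Type*} [Fintype ι] (H O : Matrix ι ι ℂ) :
    Continuous (commutatorObs H O) := by
  have h : Continuous fun A : Matrix ι ι ℂ => Aᴴ * O * A :=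
    (continuous_id.matrix_conjTranspose.matrix_mul continuous_const).matrix_mul continuous_id
  exact ((continuous_const.matrix_mul h).sub (h.matrix_mul continuous_const)).const_smul Complex.I

lemma commutatorObs_apply {d : ℕ} (H O W : Matrix (Fin d) (Fin d) ℂ) (i j : Fin d) :
    commutatorObs H O W i j =
      Complex.I * ∑ k, (H i k * (Wᴴ * O * W) k j - H k j * (Wᴴ * O * W) i k) := by
  rw [commutatorObs]
  generalize Wᴴ * O * W = Y
  rw [Matrix.smul_apply, Matrix.sub_apply, Matrix.mul_apply, Matrix.mul_apply, smul_eq_mul,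
    Finset.sum_sub_distrib]
  simp only [mul_comm (Y i _)]

/-- The Haar mean of `W† O W` is scalar, so its commutator with `H` vanishes. -/
lemma integral_commutatorObs_apply {d : ℕ} (H O : Matrix (Fin d) (Fin d) ℂ) (i j : Fin d) :
    ∫ W, commutatorObs H O (W : Matrix _ _ ℂ) i j ∂(haarUnitary d) = 0 := by
  have hY := isConjInvariant_conj' O
  obtain ⟨a, ha⟩ := hY.exists_integral_entry
  have hint : ∀ k l, Integrable (fun W : Matrix.unitaryGroup (Fin d) ℂ =>
      ((W : Matrix (Fin d) (Fin d) ℂ)ᴴ * O * (W : Matrix (Fin d) (Fin d) ℂ)) k l)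
      (haarUnitary d) := fun k l => hY.integrable (fun A => A k l) (by fun_prop)
  have hint' : ∀ k, Integrable (fun W : Matrix.unitaryGroup (Fin d) ℂ =>
      H i k * ((W : Matrix (Fin d) (Fin d) ℂ)ᴴ * O * (W : Matrix (Fin d) (Fin d) ℂ)) k j -
      H k j * ((W : Matrix (Fin d) (Fin d) ℂ)ᴴ * O * (W : Matrix (Fin d) (Fin d) ℂ)) i k)
      (haarUnitary d) := fun k => ((hint _ _).const_mul _).sub ((hint _ _).const_mul _)
  simp only [commutatorObs_apply]
  rw [integral_const_mul, integral_finsetSum _ fun k _ => hint' k]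
  simp only [integral_sub ((hint _ _).const_mul _) ((hint _ _).const_mul _),
    integral_const_mul, ha]
  simp [Finset.sum_sub_distrib]

/-- With `Y = W† O W`, the trace `Tr[(i[H, Y])²] = 2 Tr[H² Y²] - 2 Tr[H Y H Y]` in terms of
products of two entries of `Y`. -/
lemma trace_commutatorObs_sq {d : ℕ} (H O W : Matrix (Fin d) (Fin d) ℂ) :
    (commutatorObs H O W * commutatorObs H O W).trace =
      2 * ∑ x, ∑ y, ∑ z, ((H * H) x y *
        ((Wᴴ * O * W) y z * (Wᴴ * O * W) z x)) -
      2 * ∑ x, ∑ y, ∑ z, ∑ w, (H x y * H z w *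
        ((Wᴴ * O * W) y z * (Wᴴ * O * W) w x)) := by
  rw [commutatorObs]
  generalize Wᴴ * O * W = Y
  have h1 : (H * H * (Y * Y)).trace = ∑ x, ∑ y, ∑ z, ((H * H) x y * (Y y z * Y z x)) := by
    simp only [Matrix.trace, Matrix.diag_apply, Matrix.mul_apply (M := H * H),
      Matrix.mul_apply (M := Y), Finset.mul_sum]
  have h2 : (H * Y * (H * Y)).trace =
      ∑ x, ∑ y, ∑ z, ∑ w, (H x y * H z w * (Y y z * Y w x)) := by
    simp only [Matrix.trace, Matrix.diag_apply, Matrix.mul_apply, Finset.sum_mul_sum]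
    refine Finset.sum_congr rfl fun x _ => ?_
    rw [Finset.sum_comm]
    refine Finset.sum_congr rfl fun y _ => Finset.sum_congr rfl fun z _ =>
      Finset.sum_congr rfl fun w _ => by ring
  rw [← h1, ← h2, Matrix.smul_mul, Matrix.mul_smul, smul_smul, Complex.I_mul_I, Matrix.trace_smul,
    sub_mul, mul_sub, mul_sub, Matrix.trace_sub, Matrix.trace_sub, Matrix.trace_sub]
  have t1 : (H * Y * (Y * H)).trace = (H * H * (Y * Y)).trace := by
    have := Matrix.trace_mul_comm (H * Y * Y) H
    simpa only [Matrix.mul_assoc] using this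
  have t2 : (Y * H * (H * Y)).trace = (H * H * (Y * Y)).trace := by
    have := Matrix.trace_mul_comm Y (H * H * Y)
    simpa only [Matrix.mul_assoc] using this
  have t3 : (Y * H * (Y * H)).trace = (H * Y * (H * Y)).trace := by
    have := Matrix.trace_mul_comm Y (H * Y * H)
    simpa only [Matrix.mul_assoc] using this
  rw [t1, t2, t3, smul_eq_mul]
  ring

/-- The identity part of the second moments of `W† O W` cancels between the two traces; the swap
part contributes `d Tr[H²] - Tr[H]² = d Δ(H)`. -/
lemma integral_trace_commutatorObs_sq {d : ℕ} (hd : 2 ≤ d) (H O : Matrix (Fin d) (Fin d) ℂ) :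
    ∫ W, (commutatorObs H O (W : Matrix _ _ ℂ) * commutatorObs H O (W : Matrix _ _ ℂ)).trace
      ∂(haarUnitary d) = 2 * d / ((d : ℂ) ^ 2 - 1) * Delta H * Delta O := by
  have hY := isConjInvariant_conj' O
  obtain ⟨a, ha⟩ := hY.exists_integral_mul_entry_of_trace hd O (trace_unitary_conj' O)
    (fun W => by rw [unitary_conj_mul_self', trace_unitary_conj'])
  have hint : ∀ i j k l, Integrable (fun W : Matrix.unitaryGroup (Fin d) ℂ =>
      ((W : Matrix (Fin d) (Fin d) ℂ)ᴴ * O * (W : Matrix (Fin d) (Fin d) ℂ)) i j *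
      ((W : Matrix (Fin d) (Fin d) ℂ)ᴴ * O * (W : Matrix (Fin d) (Fin d) ℂ)) k l)
      (haarUnitary d) := fun i j k l => hY.integrable (fun A => A i j * A k l) (by fun_prop)
  simp only [trace_commutatorObs_sq]
  have hi3 : ∀ x y z, Integrable (fun W : Matrix.unitaryGroup (Fin d) ℂ => (H * H) x y *
      (((W : Matrix (Fin d) (Fin d) ℂ)ᴴ * O * (W : Matrix (Fin d) (Fin d) ℂ)) y z *
      ((W : Matrix (Fin d) (Fin d) ℂ)ᴴ * O * (W : Matrix (Fin d) (Fin d) ℂ)) z x))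
      (haarUnitary d) := fun x y z => (hint _ _ _ _).const_mul _
  have hi4 : ∀ x y z w, Integrable (fun W : Matrix.unitaryGroup (Fin d) ℂ => H x y * H z w *
      (((W : Matrix (Fin d) (Fin d) ℂ)ᴴ * O * (W : Matrix (Fin d) (Fin d) ℂ)) y z *
      ((W : Matrix (Fin d) (Fin d) ℂ)ᴴ * O * (W : Matrix (Fin d) (Fin d) ℂ)) w x))
      (haarUnitary d) := fun x y z w => (hint _ _ _ _).const_mul _
  rw [integral_sub]
  rotate_left
  · exact (integrable_finsetSum _ fun x _ => integrable_finsetSum _ fun y _ =>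
      integrable_finsetSum _ fun z _ => hi3 x y z).const_mul _
  · exact (integrable_finsetSum _ fun x _ => integrable_finsetSum _ fun y _ =>
      integrable_finsetSum _ fun z _ => integrable_finsetSum _ fun w _ => hi4 x y z w).const_mul _
  rw [integral_const_mul, integral_const_mul,
    integral_finsetSum _ fun x _ => integrable_finsetSum _ fun y _ =>
      integrable_finsetSum _ fun z _ => hi3 x y z,
    integral_finsetSum _ fun x _ => integrable_finsetSum _ fun y _ =>
      integrable_finsetSum _ fun z _ => integrable_finsetSum _ fun w _ => hi4 x y z w]
  simp only [integral_finsetSum _ fun y _ => integrable_finsetSum _ fun z _ => hi3 _ y z,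
    integral_finsetSum _ fun z _ => hi3 _ _ z,
    integral_finsetSum _ fun y _ => integrable_finsetSum _ fun z _ =>
      integrable_finsetSum _ fun w _ => hi4 _ y z w,
    integral_finsetSum _ fun z _ => integrable_finsetSum _ fun w _ => hi4 _ _ z w,
    integral_finsetSum _ fun w _ => hi4 _ _ _ w, integral_const_mul, ha, and_true]
  set b := Delta O / ((d : ℂ) ^ 2 - 1) with hb
  have e1 : ∑ x, ∑ y, ∑ z : Fin d, (H * H) x y *
      ((if y = z ∧ z = x then a else 0) + if y = x then b else 0) =
      (H * H).trace * a + d * ((H * H).trace * b) := by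
    simp [mul_add, Finset.sum_add_distrib, ite_and, Matrix.trace, Finset.sum_mul, Finset.mul_sum]
  have e2 : ∑ x, ∑ y, ∑ z, ∑ w, H x y * H z w *
      ((if y = z ∧ w = x then a else 0) + if y = x ∧ z = w then b else 0) =
      (H * H).trace * a + H.trace ^ 2 * b := by
    have h1 : (H * H).trace * a = ∑ x, ∑ y, H x y * H y x * a := by
      simp [Matrix.trace, Matrix.mul_apply, Finset.sum_mul]
    have h2 : H.trace ^ 2 * b = ∑ x, ∑ z, H x x * H z z * b := by
      simp [Matrix.trace, sq, Finset.sum_mul, Finset.mul_sum]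
      rw [Finset.sum_comm]
    rw [h1, h2]
    simp [mul_add, Finset.sum_add_distrib, ite_and]
  rw [e1, e2]
  have hd0 : (d : ℂ) ≠ 0 := by
    have : d ≠ 0 := by omega
    exact_mod_cast this
  have h3 : 2 * d / ((d : ℂ) ^ 2 - 1) * Delta H * Delta O = 2 * d * Delta H * b := by
    rw [hb]
    ring
  rw [h3, Delta]
  field_simp
  ring

/-- The contribution of one block to the variance: the full contraction of the second moments of
`i [H, W† O W]` with those of `V S V†`, for independent Haar unitaries `V` and `W`. As the
commutator is traceless, only the swap part of the latter contributes. -/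
lemma integral_trace_commutatorObs_mul_sq {d : ℕ} (hd : 0 < d)
    (H O S : Matrix (Fin d) (Fin d) ℂ) :
    ∑ i, ∑ j, ∑ k, ∑ l,
      (∫ W, commutatorObs H O (W : Matrix _ _ ℂ) i j * commutatorObs H O (W : Matrix _ _ ℂ) k l
        ∂(haarUnitary d)) *
      (∫ V, ((V : Matrix (Fin d) (Fin d) ℂ) * S * (V : Matrix (Fin d) (Fin d) ℂ)ᴴ) j i *
        ((V : Matrix (Fin d) (Fin d) ℂ) * S * (V : Matrix (Fin d) (Fin d) ℂ)ᴴ) l k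
        ∂(haarUnitary d)) =
      2 * (d : ℂ) / ((d : ℂ) ^ 2 - 1) ^ 2 * Delta H * Delta O * Delta S := by
  rcases Nat.lt_or_eq_of_le hd with hd2 | rfl
  swap
  -- In dimension one the commutator vanishes, and so does the right-hand side, by `1 / 0 = 0`.
  · have h0 : ∀ (W : Matrix (Fin 1) (Fin 1) ℂ) i j, commutatorObs H O W i j = 0 := by
      intro W i j
      have h := commutatorObs_trace H O W
      rw [Matrix.trace_fin_one] at h
      rwa [Subsingleton.elim i 0, Subsingleton.elim j 0]
    simp [h0]
  · obtain ⟨a, ha⟩ := (isConjInvariant_conj S).exists_integral_mul_entry_of_trace hd2 S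
      (trace_unitary_conj S) (fun W => by rw [unitary_conj_mul_self, trace_unitary_conj])
    have hint : ∀ i j k l, Integrable (fun W : Matrix.unitaryGroup (Fin d) ℂ =>
        commutatorObs H O (W : Matrix _ _ ℂ) i j * commutatorObs H O (W : Matrix _ _ ℂ) k l)
        (haarUnitary d) := by
      intro i j k l
      have h := (continuous_commutatorObs H O).comp
        (continuous_subtype_val (p := (· ∈ Matrix.unitaryGroup (Fin d) ℂ)))
      exact continuous_integrable_haarUnitary ((h.matrix_elem i j).mul (h.matrix_elem k l))
    set b := Delta S / ((d : ℂ) ^ 2 - 1) with hb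
    have h1 : ∑ i, ∑ k, ∫ W, commutatorObs H O (W : Matrix _ _ ℂ) i i *
        commutatorObs H O (W : Matrix _ _ ℂ) k k ∂(haarUnitary d) = 0 := by
      simp only [← integral_finsetSum _ fun k _ => hint _ _ k k]
      rw [← integral_finsetSum _ fun i _ => integrable_finsetSum _ fun k _ => hint i i k k]
      have h0 : ∀ W : Matrix (Fin d) (Fin d) ℂ, ∑ i, ∑ k, commutatorObs H O W i i *
          commutatorObs H O W k k = 0 := by
        intro W
        have h := commutatorObs_trace H O W
        rw [Matrix.trace] at h
        simp only [Matrix.diag_apply] at h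
        rw [← Finset.sum_mul_sum, h, zero_mul]
      simp [h0]
    have h2 : ∑ i, ∑ j, ∫ W, commutatorObs H O (W : Matrix _ _ ℂ) i j *
        commutatorObs H O (W : Matrix _ _ ℂ) j i ∂(haarUnitary d) =
        2 * d / ((d : ℂ) ^ 2 - 1) * Delta H * Delta O := by
      rw [← integral_trace_commutatorObs_sq hd2]
      simp only [← integral_finsetSum _ fun k _ => hint _ k k _]
      rw [← integral_finsetSum _ fun i _ => integrable_finsetSum _ fun k _ => hint i k k i]
      simp only [Matrix.trace, Matrix.diag_apply, Matrix.mul_apply]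
    simp only [ha]
    calc _ = (∑ i, ∑ k, ∫ W, commutatorObs H O (W : Matrix _ _ ℂ) i i *
        commutatorObs H O (W : Matrix _ _ ℂ) k k ∂(haarUnitary d)) * a +
        (∑ i, ∑ j, ∫ W, commutatorObs H O (W : Matrix _ _ ℂ) i j *
        commutatorObs H O (W : Matrix _ _ ℂ) j i ∂(haarUnitary d)) * b := by
          simp [mul_add, Finset.sum_add_distrib, ite_and, Finset.sum_mul]
      _ = _ := by
          rw [h1, h2, hb]
          generalize (d : ℂ) ^ 2 - 1 = q
          ring

/-! ### Balanced polynomials -/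

lemma one_mem_balancedPolynomials (t d : ℕ) : (fun _ => 1) ∈ balancedPolynomials t d :=
  Submodule.subset_span ⟨0, Nat.zero_le _, Fin.elim0, Fin.elim0, Fin.elim0, Fin.elim0, by simp⟩

lemma balancedPolynomials_mono {s t : ℕ} (h : s ≤ t) (d : ℕ) :
    balancedPolynomials s d ≤ balancedPolynomials t d :=
  Submodule.span_mono fun _ ⟨r, hr, x⟩ => ⟨r, hr.trans h, x⟩

lemma entry_mul_star_mem_balancedPolynomials {d : ℕ} (i j k l : Fin d) :
    (fun V : Matrix (Fin d) (Fin d) ℂ => V i j * star (V k l)) ∈ balancedPolynomials 1 d :=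
  Submodule.subset_span ⟨1, le_rfl, fun _ => i, fun _ => j, fun _ => k, fun _ => l, by simp⟩

lemma mul_mem_balancedPolynomials {s t d : ℕ} {f g : Matrix (Fin d) (Fin d) ℂ → ℂ}
    (hf : f ∈ balancedPolynomials s d) (hg : g ∈ balancedPolynomials t d) :
    f * g ∈ balancedPolynomials (s + t) d := by
  have h := Submodule.mul_mem_mul hf hg
  rw [balancedPolynomials, balancedPolynomials, Submodule.span_mul_span] at h
  refine Submodule.span_mono ?_ h
  rintro _ ⟨_, ⟨p, hp, i, j, k, l, rfl⟩, _, ⟨q, hq, i', j', k', l', rfl⟩, rfl⟩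
  refine ⟨p + q, Nat.add_le_add hp hq, Fin.append i i', Fin.append j j', Fin.append k k',
    Fin.append l l', ?_⟩
  funext V
  simp [Fin.prod_univ_add]

lemma conj_apply_mem_balancedPolynomials {d : ℕ} (X : Matrix (Fin d) (Fin d) ℂ) (i j : Fin d) :
    (fun V : Matrix (Fin d) (Fin d) ℂ => (V * X * Vᴴ) i j) ∈ balancedPolynomials 1 d := by
  have h : (fun V : Matrix (Fin d) (Fin d) ℂ => (V * X * Vᴴ) i j) =
      ∑ b, ∑ a, X a b • fun V : Matrix (Fin d) (Fin d) ℂ => V i a * star (V j b) := by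
    funext V
    simp only [Matrix.mul_apply, Finset.sum_apply, Pi.smul_apply, smul_eq_mul, Finset.sum_mul,
      Matrix.conjTranspose_apply]
    refine Finset.sum_congr rfl fun b _ => Finset.sum_congr rfl fun a _ => by ring
  rw [h]
  exact Submodule.sum_mem _ fun b _ => Submodule.sum_mem _ fun a _ =>
    Submodule.smul_mem _ _ (entry_mul_star_mem_balancedPolynomials _ _ _ _)

lemma conj'_apply_mem_balancedPolynomials {d : ℕ} (X : Matrix (Fin d) (Fin d) ℂ) (i j : Fin d) :
    (fun V : Matrix (Fin d) (Fin d) ℂ => (Vᴴ * X * V) i j) ∈ balancedPolynomials 1 d := by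
  have h : (fun V : Matrix (Fin d) (Fin d) ℂ => (Vᴴ * X * V) i j) =
      ∑ b, ∑ a, X a b • fun V : Matrix (Fin d) (Fin d) ℂ => V b j * star (V a i) := by
    funext V
    simp only [Matrix.mul_apply, Finset.sum_apply, Pi.smul_apply, smul_eq_mul, Finset.sum_mul,
      Matrix.conjTranspose_apply]
    refine Finset.sum_congr rfl fun b _ => Finset.sum_congr rfl fun a _ => by ring
  rw [h]
  exact Submodule.sum_mem _ fun b _ => Submodule.sum_mem _ fun a _ =>
    Submodule.smul_mem _ _ (entry_mul_star_mem_balancedPolynomials _ _ _ _)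

lemma commutatorObs_apply_mem_balancedPolynomials {d : ℕ} (H O : Matrix (Fin d) (Fin d) ℂ)
    (i j : Fin d) :
    (fun W : Matrix (Fin d) (Fin d) ℂ => commutatorObs H O W i j) ∈ balancedPolynomials 1 d := by
  have h : (fun W : Matrix (Fin d) (Fin d) ℂ => commutatorObs H O W i j) =
      Complex.I • ∑ k, ((H i k • fun W : Matrix (Fin d) (Fin d) ℂ => (Wᴴ * O * W) k j) -
        H k j • fun W : Matrix (Fin d) (Fin d) ℂ => (Wᴴ * O * W) i k) := by
    funext W
    simp [commutatorObs_apply]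
  rw [h]
  exact Submodule.smul_mem _ _ (Submodule.sum_mem _ fun k _ => Submodule.sub_mem _
    (Submodule.smul_mem _ _ (conj'_apply_mem_balancedPolynomials _ _ _))
    (Submodule.smul_mem _ _ (conj'_apply_mem_balancedPolynomials _ _ _)))

/-! ### Averages over independent designs -/

namespace FormsIndependentDesigns

variable {t : ℕ} {Ω : Type} [MeasurableSpace Ω] {P : Measure Ω} {Λ : Type} [Fintype Λ] {d : Λ → ℕ}
  {V : (k : Λ × Bool) → Ω → Matrix (Fin (d k.1)) (Fin (d k.1)) ℂ}

/-- The design property, with the two unitaries of each block grouped together. -/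
lemma integral_prod_mul (h : FormsIndependentDesigns t P (fun k : Λ × Bool => d k.1) V)
    (f g : (lam : Λ) → Matrix (Fin (d lam)) (Fin (d lam)) ℂ → ℂ)
    (hf : ∀ lam, f lam ∈ balancedPolynomials t (d lam))
    (hg : ∀ lam, g lam ∈ balancedPolynomials t (d lam)) :
    ∫ ω, ∏ lam, (f lam (V (lam, true) ω) * g lam (V (lam, false) ω)) ∂P =
      ∏ lam, ((∫ W, f lam (W : Matrix _ _ ℂ) ∂(haarUnitary (d lam))) *
        ∫ W, g lam (W : Matrix _ _ ℂ) ∂(haarUnitary (d lam))) := by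
  have h' := h (fun k => cond k.2 (f k.1) (g k.1)) (by
    rintro ⟨lam, b⟩
    cases b
    · exact hg lam
    · exact hf lam)
  simpa [Fintype.prod_prod_type] using h'

lemma integral_mul (h : FormsIndependentDesigns t P (fun k : Λ × Bool => d k.1) V) (lam : Λ)
    {f g : Matrix (Fin (d lam)) (Fin (d lam)) ℂ → ℂ}
    (hf : f ∈ balancedPolynomials t (d lam)) (hg : g ∈ balancedPolynomials t (d lam)) :
    ∫ ω, f (V (lam, true) ω) * g (V (lam, false) ω) ∂P =
      (∫ W, f (W : Matrix _ _ ℂ) ∂(haarUnitary (d lam))) *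
        ∫ W, g (W : Matrix _ _ ℂ) ∂(haarUnitary (d lam)) := by
  classical
  have h' := h.integral_prod_mul (Function.update (fun _ _ => 1) lam f)
    (Function.update (fun _ _ => 1) lam g)
    (fun k => by
      rcases eq_or_ne k lam with rfl | hk
      · simpa using hf
      · simpa [hk] using one_mem_balancedPolynomials t (d k))
    (fun k => by
      rcases eq_or_ne k lam with rfl | hk
      · simpa using hg
      · simpa [hk] using one_mem_balancedPolynomials t (d k))
  rw [Finset.prod_eq_single lam (fun k _ hk => by simp [hk]) (by simp)] at h'
  have hp : ∀ ω, ∏ k, (Function.update (β := fun k => Matrix (Fin (d k)) (Fin (d k)) ℂ → ℂ)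
      (fun _ _ => 1) lam f k (V (k, true) ω) *
      Function.update (β := fun k => Matrix (Fin (d k)) (Fin (d k)) ℂ → ℂ)
      (fun _ _ => 1) lam g k (V (k, false) ω)) = f (V (lam, true) ω) * g (V (lam, false) ω) := by
    intro ω
    rw [Finset.prod_eq_single lam (fun k _ hk => by simp [hk]) (by simp)]
    simp
  simp only [hp] at h'
  simpa using h'

lemma integral_mul_mul_of_ne (h : FormsIndependentDesigns t P (fun k : Λ × Bool => d k.1) V)
    {lam lam' : Λ} (hne : lam ≠ lam') {f g : Matrix (Fin (d lam)) (Fin (d lam)) ℂ → ℂ}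
    {f' g' : Matrix (Fin (d lam')) (Fin (d lam')) ℂ → ℂ}
    (hf : f ∈ balancedPolynomials t (d lam)) (hg : g ∈ balancedPolynomials t (d lam))
    (hf' : f' ∈ balancedPolynomials t (d lam')) (hg' : g' ∈ balancedPolynomials t (d lam')) :
    ∫ ω, f (V (lam, true) ω) * g (V (lam, false) ω) *
        (f' (V (lam', true) ω) * g' (V (lam', false) ω)) ∂P =
      (∫ W, f (W : Matrix _ _ ℂ) ∂(haarUnitary (d lam))) *
        (∫ W, g (W : Matrix _ _ ℂ) ∂(haarUnitary (d lam))) *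
      ((∫ W, f' (W : Matrix _ _ ℂ) ∂(haarUnitary (d lam'))) *
        ∫ W, g' (W : Matrix _ _ ℂ) ∂(haarUnitary (d lam'))) := by
  classical
  let F : (Matrix (Fin (d lam)) (Fin (d lam)) ℂ → ℂ) →
      (Matrix (Fin (d lam')) (Fin (d lam')) ℂ → ℂ) →
      (k : Λ) → Matrix (Fin (d k)) (Fin (d k)) ℂ → ℂ := fun f f' =>
    Function.update (Function.update (fun _ _ => 1) lam f) lam' f'
  have hF1 : ∀ f f', F f f' lam = f := fun f f' => by simp [F, hne]
  have hF2 : ∀ f f', F f f' lam' = f' := fun f f' => by simp [F]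
  have hF3 : ∀ f f' k, k ≠ lam → k ≠ lam' → F f f' k = fun _ => 1 := fun f f' k h1 h2 => by
    simp [F, h1, h2]
  have hmem : ∀ {f f'}, f ∈ balancedPolynomials t (d lam) →
      f' ∈ balancedPolynomials t (d lam') → ∀ k, F f f' k ∈ balancedPolynomials t (d k) := by
    intro f f' hf hf' k
    rcases eq_or_ne k lam' with rfl | hk'
    · rwa [hF2]
    · rcases eq_or_ne k lam with rfl | hk
      · rwa [hF1]
      · rw [hF3 _ _ k hk hk']
        exact one_mem_balancedPolynomials t (d k)
  have h' := h.integral_prod_mul _ _ (hmem hf hf') (hmem hg hg')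
  rw [Finset.prod_eq_mul lam lam' hne
    (fun k _ hk => by simp [hF3 _ _ k hk.1 hk.2]) (by simp) (by simp), hF1, hF1, hF2, hF2] at h'
  rw [← h']
  refine integral_congr_ae (Filter.Eventually.of_forall fun ω => ?_)
  dsimp only
  rw [Finset.prod_eq_mul lam lam' hne
    (fun k _ hk => by simp [hF3 _ _ k hk.1 hk.2]) (by simp) (by simp), hF1, hF1, hF2, hF2]

/-- The mean of a sum of products of balanced polynomials, one in each part, vanishes if one factor
of every product is centred under the Haar measure. -/
lemma integral_sum_eq_zero {t : ℕ}
    (h : FormsIndependentDesigns t P (fun k : Λ × Bool => d k.1) V)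
    {f g : (lam : Λ) → Fin (d lam) → Fin (d lam) → Matrix (Fin (d lam)) (Fin (d lam)) ℂ → ℂ}
    (hf : ∀ lam i j, f lam i j ∈ balancedPolynomials t (d lam))
    (hg : ∀ lam i j, g lam i j ∈ balancedPolynomials t (d lam))
    (hint : ∀ lam i j, Integrable
      (fun ω => f lam i j (V (lam, true) ω) * g lam j i (V (lam, false) ω)) P)
    (hmean : ∀ lam i j, ∫ W, f lam i j (W : Matrix _ _ ℂ) ∂haarUnitary (d lam) = 0) :
    ∫ ω, ∑ lam, ∑ i, ∑ j, f lam i j (V (lam, true) ω) * g lam j i (V (lam, false) ω) ∂P = 0 := by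
  rw [integral_finsetSum _ fun lam _ => integrable_finsetSum _ fun i _ =>
    integrable_finsetSum _ fun j _ => hint lam i j]
  refine Finset.sum_eq_zero fun lam _ => ?_
  rw [integral_finsetSum _ fun i _ => integrable_finsetSum _ fun j _ => hint lam i j]
  refine Finset.sum_eq_zero fun i _ => ?_
  rw [integral_finsetSum _ fun j _ => hint lam i j]
  refine Finset.sum_eq_zero fun j _ => ?_
  rw [h.integral_mul lam (hf lam i j) (hg lam j i), hmean, zero_mul]

/-- In the second moment of such a sum the cross terms between different blocks vanish, since each
of them has a centred factor. -/
lemma integral_sum_mul_sum (h : FormsIndependentDesigns 2 P (fun k : Λ × Bool => d k.1) V)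
    {f g : (lam : Λ) → Fin (d lam) → Fin (d lam) → Matrix (Fin (d lam)) (Fin (d lam)) ℂ → ℂ}
    (hf : ∀ lam i j, f lam i j ∈ balancedPolynomials 1 (d lam))
    (hg : ∀ lam i j, g lam i j ∈ balancedPolynomials 1 (d lam))
    (hint : ∀ lam i j lam' k l, Integrable
      (fun ω => f lam i j (V (lam, true) ω) * g lam j i (V (lam, false) ω) *
        (f lam' k l (V (lam', true) ω) * g lam' l k (V (lam', false) ω))) P)
    (hmean : ∀ lam i j, ∫ W, f lam i j (W : Matrix _ _ ℂ) ∂haarUnitary (d lam) = 0) :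
    ∫ ω, (∑ lam, ∑ i, ∑ j, f lam i j (V (lam, true) ω) * g lam j i (V (lam, false) ω)) *
        (∑ lam, ∑ i, ∑ j, f lam i j (V (lam, true) ω) * g lam j i (V (lam, false) ω)) ∂P =
      ∑ lam, ∑ i, ∑ j, ∑ k, ∑ l,
        (∫ W, f lam i j (W : Matrix _ _ ℂ) * f lam k l (W : Matrix _ _ ℂ)
          ∂haarUnitary (d lam)) *
        ∫ W, g lam j i (W : Matrix _ _ ℂ) * g lam l k (W : Matrix _ _ ℂ)
          ∂haarUnitary (d lam) := by
  classical
  have hcross : ∀ lam i j lam' k l, lam ≠ lam' →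
      ∫ ω, f lam i j (V (lam, true) ω) * g lam j i (V (lam, false) ω) *
        (f lam' k l (V (lam', true) ω) * g lam' l k (V (lam', false) ω)) ∂P = 0 := by
    intro lam i j lam' k l hne
    rw [h.integral_mul_mul_of_ne hne (balancedPolynomials_mono one_le_two _ (hf lam i j))
      (balancedPolynomials_mono one_le_two _ (hg lam j i))
      (balancedPolynomials_mono one_le_two _ (hf lam' k l))
      (balancedPolynomials_mono one_le_two _ (hg lam' l k)), hmean, zero_mul, zero_mul]
  have hdiag : ∀ lam i j k l, ∫ ω, f lam i j (V (lam, true) ω) * g lam j i (V (lam, false) ω) *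
        (f lam k l (V (lam, true) ω) * g lam l k (V (lam, false) ω)) ∂P =
      (∫ W, f lam i j (W : Matrix _ _ ℂ) * f lam k l (W : Matrix _ _ ℂ)
          ∂haarUnitary (d lam)) *
        ∫ W, g lam j i (W : Matrix _ _ ℂ) * g lam l k (W : Matrix _ _ ℂ)
          ∂haarUnitary (d lam) := by
    intro lam i j k l
    have h1 := mul_mem_balancedPolynomials (hf lam i j) (hf lam k l)
    have h2 := mul_mem_balancedPolynomials (hg lam j i) (hg lam l k)
    rw [one_add_one_eq_two] at h1 h2
    have h' := h.integral_mul lam h1 h2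
    simp only [Pi.mul_apply] at h'
    rw [← h']
    simp only [mul_mul_mul_comm (f lam i j _)]
  simp only [← hdiag]
  let X : (lam : Λ) → Fin (d lam) → Fin (d lam) → Ω → ℂ := fun lam i j ω =>
    f lam i j (V (lam, true) ω) * g lam j i (V (lam, false) ω)
  have hi0 : ∀ lam i j lam' k l, Integrable (fun ω => X lam i j ω * X lam' k l ω) P := hint
  change ∫ ω, (∑ lam, ∑ i, ∑ j, X lam i j ω) * (∑ lam, ∑ i, ∑ j, X lam i j ω) ∂P =
    ∑ lam, ∑ i, ∑ j, ∑ k, ∑ l, ∫ ω, X lam i j ω * X lam k l ω ∂P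
  have hc : ∀ lam i j lam' k l, lam ≠ lam' → ∫ ω, X lam i j ω * X lam' k l ω ∂P = 0 := hcross
  clear_value X
  have hexp : ∀ ω, (∑ lam, ∑ i, ∑ j, X lam i j ω) * (∑ lam, ∑ i, ∑ j, X lam i j ω) =
      ∑ lam, ∑ lam', ∑ i, ∑ j, ∑ k, ∑ l, X lam i j ω * X lam' k l ω := by
    intro ω
    rw [Finset.sum_mul_sum]
    refine Finset.sum_congr rfl fun lam _ => Finset.sum_congr rfl fun lam' _ => ?_
    rw [Finset.sum_mul]
    refine Finset.sum_congr rfl fun i _ => ?_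
    rw [Finset.sum_mul]
    refine Finset.sum_congr rfl fun j _ => ?_
    simp only [Finset.mul_sum]
  have hi1 : ∀ lam lam' i j k, Integrable (fun ω => ∑ l, X lam i j ω * X lam' k l ω) P :=
    fun lam lam' i j k => integrable_finsetSum _ fun l _ => hi0 lam i j lam' k l
  have hi2 : ∀ lam lam' i j, Integrable (fun ω => ∑ k, ∑ l, X lam i j ω * X lam' k l ω) P :=
    fun lam lam' i j => integrable_finsetSum _ fun k _ => hi1 lam lam' i j k
  have hi3 : ∀ lam lam' i, Integrable (fun ω => ∑ j, ∑ k, ∑ l, X lam i j ω * X lam' k l ω) P :=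
    fun lam lam' i => integrable_finsetSum _ fun j _ => hi2 lam lam' i j
  have hi4 : ∀ lam lam', Integrable (fun ω => ∑ i, ∑ j, ∑ k, ∑ l,
      X lam i j ω * X lam' k l ω) P :=
    fun lam lam' => integrable_finsetSum _ fun i _ => hi3 lam lam' i
  have hterm : ∀ lam lam', ∫ ω, ∑ i, ∑ j, ∑ k, ∑ l, X lam i j ω * X lam' k l ω ∂P =
      ∑ i, ∑ j, ∑ k, ∑ l, ∫ ω, X lam i j ω * X lam' k l ω ∂P := by
    intro lam lam'
    rw [integral_finsetSum _ fun i _ => hi3 lam lam' i]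
    refine Finset.sum_congr rfl fun i _ => ?_
    rw [integral_finsetSum _ fun j _ => hi2 lam lam' i j]
    refine Finset.sum_congr rfl fun j _ => ?_
    rw [integral_finsetSum _ fun k _ => hi1 lam lam' i j k]
    refine Finset.sum_congr rfl fun k _ => ?_
    rw [integral_finsetSum _ fun l _ => hi0 lam i j lam' k l]
  simp only [hexp]
  rw [integral_finsetSum _ fun lam _ => integrable_finsetSum _ fun lam' _ => hi4 lam lam']
  refine Finset.sum_congr rfl fun lam _ => ?_
  rw [integral_finsetSum _ fun lam' _ => hi4 lam lam', Finset.sum_eq_single lam, hterm]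
  · intro lam' _ hne
    rw [hterm]
    exact Finset.sum_eq_zero fun i _ => Finset.sum_eq_zero fun j _ => Finset.sum_eq_zero fun k _ =>
      Finset.sum_eq_zero fun l _ => hc lam i j lam' k l hne.symm
  · simp

end FormsIndependentDesigns

/-! ### Mean and variance of the gradient -/

section Gradient

variable {n L : ℕ} {Λ : Type} [Fintype Λ] (D : IsotypicDecomposition n Λ)
  (copy : (lam : Λ) → Fin (D.m lam)) {H : Fin L → Op n} {O : Op n}

/-- The gradient splits into contributions of the blocks. -/
lemma lossGradient_eq_sum (hH : ∀ l, IsEquivariant (H l)) (hO : IsEquivariant O) (S : Op n)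
    (μ : Fin L) (θ : Fin L → ℝ) :
    lossGradient H O S μ θ = ∑ lam, ∑ i, ∑ j,
      commutatorObs (D.restrict lam (copy lam) (H μ)) (D.restrict lam (copy lam) O)
        (D.restrict lam (copy lam) (circuitPart H μ true θ)) i j *
      (D.restrict lam (copy lam) (circuitPart H μ false θ) * (∑ ν, D.restrict lam ν S) *
        (D.restrict lam (copy lam) (circuitPart H μ false θ))ᴴ) j i := by
  have hA := circuitPart_equivariant hH μ true θ
  have hB := circuitPart_equivariant hH μ false θ
  rw [lossGradient]
  generalize circuitPart H μ true θ = A at *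
  generalize circuitPart H μ false θ = B at *
  have hO' := (hA.conjTranspose.mul hO).mul hA
  have hC : IsEquivariant (commutatorObs (H μ) O A) := (((hH μ).mul hO').sub (hO'.mul (hH μ))).smul _
  have h1 : (commutatorObs (H μ) O A * (B * S * Bᴴ)).trace =
      (Bᴴ * commutatorObs (H μ) O A * B * S).trace := by
    have h := Matrix.trace_mul_comm (commutatorObs (H μ) O A * (B * S)) Bᴴ
    simpa only [Matrix.mul_assoc] using h
  rw [h1, D.trace_mul_eq_sum copy ((hB.conjTranspose.mul hC).mul hB)]
  refine Finset.sum_congr rfl fun lam _ => ?_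
  have h2 : D.restrict lam (copy lam) (commutatorObs (H μ) O A) =
      commutatorObs (D.restrict lam (copy lam) (H μ)) (D.restrict lam (copy lam) O)
        (D.restrict lam (copy lam) A) := by
    rw [commutatorObs, D.restrict_smul, D.restrict_sub, D.restrict_mul (hH μ), D.restrict_mul hO',
      D.restrict_mul (hA.conjTranspose.mul hO), D.restrict_mul hA.conjTranspose,
      D.restrict_conjTranspose, commutatorObs]
  rw [D.restrict_mul (hB.conjTranspose.mul hC), D.restrict_mul hB.conjTranspose, h2,
    D.restrict_conjTranspose]
  generalize D.restrict lam (copy lam) B = b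
  generalize ∑ ν, D.restrict lam ν S = s
  generalize commutatorObs (D.restrict lam (copy lam) (H μ)) (D.restrict lam (copy lam) O)
        (D.restrict lam (copy lam) A) = c
  have h3 : (bᴴ * c * b * s).trace = (c * (b * s * bᴴ)).trace := by
    have h := Matrix.trace_mul_comm bᴴ (c * b * s)
    simpa only [Matrix.mul_assoc] using h
  rw [h3]
  simp only [Matrix.trace, Matrix.diag_apply, Matrix.mul_apply (M := c)]

variable {D copy} {P : Measure (Fin L → ℝ)} [IsProbabilityMeasure P] {μ : Fin L}

/-- The summands of the gradient are continuous functions of `U_A` and `U_B`. -/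
lemma continuous_gradient_factors (lam : Λ) (K O S : Matrix (Fin (D.d lam)) (Fin (D.d lam)) ℂ)
    (i j : Fin (D.d lam)) :
    Continuous fun q : Op n × Op n => commutatorObs K O (D.restrict lam (copy lam) q.1) i j *
      (D.restrict lam (copy lam) q.2 * S * (D.restrict lam (copy lam) q.2)ᴴ) j i := by
  have h1 := D.continuous_restrict lam (copy lam)
  have h2 := continuous_commutatorObs K O
  exact ((h2.comp (h1.comp continuous_fst)).matrix_elem i j).mul
    (Continuous.matrix_elem (by fun_prop) j i)

lemma integral_lossGradient (hH : ∀ l, IsEquivariant (H l)) (hH' : ∀ l, (H l).IsHermitian)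
    (hO : IsEquivariant O) (S : Op n)
    (hdesign : FormsIndependentDesigns 2 P (K := Λ × Bool) (fun k => D.d k.1)
      (fun k θ => D.restrict k.1 (copy k.1) (circuitPart H μ k.2 θ))) :
    ∫ θ, lossGradient H O S μ θ ∂P = 0 := by
  simp only [lossGradient_eq_sum D copy hH hO]
  exact hdesign.integral_sum_eq_zero
    (f := fun lam i j W => commutatorObs (D.restrict lam (copy lam) (H μ))
      (D.restrict lam (copy lam) O) W i j)
    (g := fun lam i j V => (V * (∑ ν, D.restrict lam ν S) * Vᴴ) i j)
    (fun lam i j => balancedPolynomials_mono one_le_two _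
      (commutatorObs_apply_mem_balancedPolynomials _ _ i j))
    (fun lam i j => balancedPolynomials_mono one_le_two _
      (conj_apply_mem_balancedPolynomials _ i j))
    (fun lam i j => memLp_one_iff_integrable.mp
      (memLp_circuitPart hH' μ P 1 _ (continuous_gradient_factors lam _ _ _ i j)))
    (fun lam i j => integral_commutatorObs_apply _ _ i j)

lemma integral_lossGradient_sq (hH : ∀ l, IsEquivariant (H l)) (hH' : ∀ l, (H l).IsHermitian)
    (hO : IsEquivariant O) (S : Op n)
    (hdesign : FormsIndependentDesigns 2 P (K := Λ × Bool) (fun k => D.d k.1)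
      (fun k θ => D.restrict k.1 (copy k.1) (circuitPart H μ k.2 θ))) :
    ∫ θ, lossGradient H O S μ θ * lossGradient H O S μ θ ∂P =
      ∑ lam, (2 * (D.d lam : ℂ) / ((D.d lam : ℂ) ^ 2 - 1) ^ 2) *
        Delta (D.restrict lam (copy lam) (H μ)) * Delta (D.restrict lam (copy lam) O) *
        Delta (∑ ν, D.restrict lam ν S) := by
  simp only [lossGradient_eq_sum D copy hH hO]
  have h := hdesign.integral_sum_mul_sum
    (f := fun lam i j W => commutatorObs (D.restrict lam (copy lam) (H μ))
      (D.restrict lam (copy lam) O) W i j)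
    (g := fun lam i j V => (V * (∑ ν, D.restrict lam ν S) * Vᴴ) i j)
    (fun lam i j => commutatorObs_apply_mem_balancedPolynomials _ _ i j)
    (fun lam i j => conj_apply_mem_balancedPolynomials _ i j)
    (fun lam i j lam' k l => memLp_one_iff_integrable.mp
      (memLp_circuitPart hH' μ P 1 _ ((continuous_gradient_factors lam _ _ _ i j).mul
        (continuous_gradient_factors lam' _ _ _ k l))))
    (fun lam i j => integral_commutatorObs_apply _ _ i j)
  refine h.trans (Finset.sum_congr rfl fun lam _ => ?_)
  exact integral_trace_commutatorObs_mul_sq (D.d_pos lam) _ _ _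

/-- The gradient as a continuous function of `U_A` and `U_B`. -/
lemma continuous_trace_commutatorObs_mul (S : Op n) (K : Op n) :
    Continuous fun q : Op n × Op n => (commutatorObs K O q.1 * (q.2 * S * q.2ᴴ)).trace := by
  have h := continuous_commutatorObs K O
  fun_prop

end Gradient

end EquivariantQNN

end

open EquivariantQNN MeasureTheory ProbabilityTheory in
theorem theorem1 {n L M : ℕ} {Λ : Type} [Fintype Λ] (D : IsotypicDecomposition n Λ)
    (copy : (lam : Λ) → Fin (D.m lam))
    (H : Fin L → Op n) (hH : ∀ l, H l ∈ generators n)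
    (O : Op n) (hO : O ∈ measurements n)
    (c : Fin M → ℝ) (ρ : Fin M → Op n) (hρ : ∀ i, IsDensityMatrix (ρ i))
    (P : Measure (Fin L → ℝ)) [IsProbabilityMeasure P] (μ : Fin L)
    (hdesign : FormsIndependentDesigns 2 P (K := Λ × Bool) (fun k => D.d k.1)
      (fun k θ => D.restrict k.1 (copy k.1) (circuitPart H μ k.2 θ))) :
    (∀ θ, Differentiable ℝ fun t : ℝ => empiricalLoss H O c ρ (Function.update θ μ t)) ∧
    MemLp (partialDeriv (empiricalLoss H O c ρ) μ) 2 P ∧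
    ∫ θ, partialDeriv (empiricalLoss H O c ρ) μ θ ∂P = 0 ∧
    ((variance (partialDeriv (empiricalLoss H O c ρ) μ) P : ℝ) : ℂ) =
      ∑ lam, (2 * (D.d lam : ℂ) / ((D.d lam : ℂ) ^ 2 - 1) ^ 2) *
        Delta (D.restrict lam (copy lam) (H μ)) *
        Delta (D.restrict lam (copy lam) O) *
        Delta (∑ ν, D.restrict lam ν (∑ i, (c i : ℂ) • ρ i)) := by
  have hHe := fun l => equivariant_of_mem_generators (hH l)
  have hHh := fun l => isHermitian_of_mem_generators (hH l)
  have hOe := equivariant_of_mem_measurements hO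
  have hreal := partialDeriv_empiricalLoss c μ (hHh μ) (isHermitian_of_mem_measurements hO)
    (fun i => (hρ i).1.isHermitian)
  have hmem : MemLp (partialDeriv (empiricalLoss H O c ρ) μ) 2 P := by
    have h := (memLp_circuitPart hHh μ P 2 _
      (continuous_trace_commutatorObs_mul (O := O) (∑ i, (c i : ℂ) • ρ i) (H μ))).re
    have hre : partialDeriv (empiricalLoss H O c ρ) μ =
        fun θ => (lossGradient H O (∑ i, (c i : ℂ) • ρ i) μ θ).re := by
      funext θ
      rw [← hreal, Complex.ofReal_re]
    rw [hre]
    exact h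
  have hmean : ∫ θ, partialDeriv (empiricalLoss H O c ρ) μ θ ∂P = 0 := by
    have h := integral_lossGradient hHe hHh hOe (∑ i, (c i : ℂ) • ρ i) hdesign
    simp only [← hreal] at h
    rw [integral_complex_ofReal] at h
    exact_mod_cast h
  refine ⟨fun θ t => ?_, hmem, hmean, ?_⟩
  · have h := hasDerivAt_empiricalLoss O c ρ μ (hHh μ) (Function.update θ μ t)
    simp only [Function.update_idem, Function.update_self] at h
    exact h.differentiableAt
  · rw [variance_of_integral_eq_zero hmem.aestronglyMeasurable.aemeasurable hmean,
      ← integral_lossGradient_sq hHe hHh hOe (∑ i, (c i : ℂ) • ρ i) hdesign, ← integral_complex_ofReal]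
    simp only [← hreal]
    refine integral_congr_ae (Filter.Eventually.of_forall fun θ => ?_)
    simp [sq]
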